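/- A cLD election $(G(N,E),v,d)$ consists of a finite directed graph $G(N,E)$ on a set $N$ of voters, together with a voting cost $v(i)\in\mathbb N$ and a delegation cost $d(i)\in\mathbb N$ (possibly zero) for each $i\in N$. Let $\Delta$ be the maximum out-degree of $G$. A solution is a pair $(C,D)$ where $C\subseteq N$ is the set of casting voters and $D\subseteq E$ consists of exactly one outgoing edge for each voter in $N\setminus C$ (and of no other edges). Bounded Max Length is the following decision problem. Input: a cLD election $(G(N,E),v,d)$, a budget $\beta\in\mathbb N$, $\beta\ge 1$, and a parameter $\ell\in\mathbb N$, $\ell\ge 1$, with all numbers written in binary. Question: does there exist a solution $(C,D)$ such that (i) $\sum_{i\in C}v(i)+\sum_{i\notin C}d(i)\le\beta$; (ii) for every $i\in N\setminus C$ there is a directed path from $i$ to a vertex of $C$ using only edges of $D$; and (iii) for every $i\in N\setminus C$, the path from $i$ to its nearest voter in $C$ via edges of $D$ has length at most $\ell$? **Theorem.** Bounded Max Length, restricted to inputs with $\Delta\le 1$, is solvable in polynomial time: there are a deterministic Turing machine and a polynomial $p$ such that on every such input, encoded as a word of length $m$, the machine halts with the correct yes/no answer within $p(m)$ steps. -/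

import Mathlib

/-- A cLD election with finite voter set `N`: the edge set `E` of the delegation graph, where
`(i, j) ∈ E` means that `i` approves `j` as an immediate representative, together with a voting
cost `v i` and a delegation cost `d i` for every voter `i`. -/
structure CLDElection (N : Type) where
  E : Finset (N × N)
  v : N → ℕ
  d : N → ℕ

namespace CLDElection

variable {N : Type} [Fintype N] [DecidableEq N]

/-- The out-degree of voter `i` in the delegation graph. -/
def outDegree (G : CLDElection N) (i : N) : ℕ :=
  (G.E.filter (fun e => e.1 = i)).card

/-- The parameter `Δ`: the maximum out-degree of the delegation graph. -/
def maxOutDegree (G : CLDElection N) : ℕ :=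
  Finset.univ.sup G.outDegree

/-- `(C, D)` is a solution: `D ⊆ E` consists of exactly one outgoing edge for each voter outside
the set `C` of casting voters (and of no other edges). -/
def IsSolution (G : CLDElection N) (C : Finset N) (D : Finset (N × N)) : Prop :=
  D ⊆ G.E ∧ (∀ e ∈ D, e.1 ∉ C) ∧ ∀ i, i ∉ C → ∃! j, (i, j) ∈ D

/-- The total cost of a solution with set `C` of casting voters. -/
def cost (G : CLDElection N) (C : Finset N) : ℕ :=
  ∑ i ∈ C, G.v i + ∑ i ∈ Cᶜ, G.d i

end CLDElection

/-- `HasPath D k i j`: the edges of `D` lead from `i` to `j` in exactly `k` steps. -/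
def HasPath {N : Type} (D : Finset (N × N)) : ℕ → N → N → Prop
  | 0, i, j => i = j
  | k + 1, i, j => ∃ m, (i, m) ∈ D ∧ HasPath D k m j

/-- The reachability constraint: every delegating voter has a directed path via `D` to a casting
voter. -/
def ReachabilityConstraint {N : Type} (C : Finset N) (D : Finset (N × N)) : Prop :=
  ∀ i, i ∉ C → ∃ c ∈ C, ∃ k, HasPath D k i c

/-- Every delegating voter is at distance at most `ℓ` via `D` from its nearest casting voter. -/
def PathLengthsAtMost {N : Type} (C : Finset N) (D : Finset (N × N)) (ℓ : ℕ) : Prop :=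
  ∀ i, i ∉ C → ∃ c ∈ C, ∃ k ≤ ℓ, HasPath D k i c

/-- An input of Bounded Max Length: a cLD election (on voters numbered `0, …, n - 1`), a budget
`β ≥ 1` and a length bound `ℓ ≥ 1`. -/
structure BMLInput where
  n : ℕ
  G : CLDElection (Fin n)
  β : ℕ
  ℓ : ℕ
  β_pos : 0 < β
  ℓ_pos : 0 < ℓ

/-- The question of Bounded Max Length. -/
def BoundedMaxLength (I : BMLInput) : Prop :=
  ∃ (C : Finset (Fin I.n)) (D : Finset (Fin I.n × Fin I.n)),
    I.G.IsSolution C D ∧ I.G.cost C ≤ I.β ∧ ReachabilityConstraint C D ∧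
      PathLengthsAtMost C D I.ℓ

namespace BMLInput

open Computability

/-- A natural number in binary (least significant bit first), terminated by a comma. -/
def encodeNumber (m : ℕ) : List Γ' :=
  (encodeNat m).map Γ'.bit ++ [Γ'.comma]

/-- The block of voter `i`: both costs in binary and the row of `i` in the adjacency matrix of the
delegation graph, enclosed in brackets. -/
def encodeVoter (I : BMLInput) (i : Fin I.n) : List Γ' :=
  [Γ'.bra] ++ encodeNumber (I.G.v i) ++ encodeNumber (I.G.d i) ++
    (List.finRange I.n).map (fun j => Γ'.bit (decide ((i, j) ∈ I.G.E))) ++ [Γ'.ket]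

/-- The input as a word over a finite alphabet: `β` and `ℓ` in binary, then the voters' blocks. -/
def encode (I : BMLInput) : List Γ' :=
  encodeNumber I.β ++ encodeNumber I.ℓ ++ (List.finRange I.n).flatMap I.encodeVoter

end BMLInput

open Classical in
/-- The decision problem `P`, whose inputs are presented to the machine as the words `enc a`, is
solvable in polynomial time: some Turing machine, started on `enc a`, halts with the correct
yes/no answer after at most `p (length of enc a)` steps, for a fixed polynomial `p`. -/
def SolvableInPolyTime {α Γ : Type} (enc : α → List Γ) (P : α → Prop) : Prop :=
  Nonempty (Turing.TM2ComputableInPolyTime enc Computability.encodeBool (fun a => decide (P a)))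

/-! With out-degree at most one, every voter `i` has at most one possible delegate `f i`; write `f i
= n` if there is none. The edge set of a solution is then determined by the casting voters, and a
solution within the length bound is the same as a distance function `δ` with values at most `ℓ` such
that each voter has `δ i = 0` (it casts) or `δ i = δ (f i) + 1` (`boundedMaxLength_iff`). The cost
is a sum of terms depending only on `i` and on whether `δ i = 0`.

Each component of the graph ends in a sink or in exactly one cycle. A sink must cast, and some voter
on the cycle must cast, since `δ` cannot decrease forever. Once `j` is known to cast, its outgoing
edge is irrelevant; deleting it turns the component into a tree directed towards `j`. On this tree a
dynamic program is exact: if `i` has distance `k`, its subtree costs its own cost plus, for each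
child, the cheaper of casting (distance `0`) and, for `k < L`, delegating (distance `k + 1`). Any
`δ` costs at least the resulting value (`dp_le_sum`), and choosing greedily from `j` outwards
attains it (`exists_sum_eq_dp`). Minimizing over the possible `j` and adding over components gives
the optimum (`exists_valid_iff`).

Two truncations keep the data small although `ℓ` and the costs are binary: distances are always
below `n`, so `ℓ` may be replaced by `min ℓ n` (`Valid.min`), and costs are cut off at `β + 1`,
which does not affect the comparison with `β` (`totalCost_le_iff`).

For the machine model, structured stack programs are compiled to Turing machines with the same step
count (`Exec.steps`). Data are binary trees in prefix notation on one stack, and the predicate `PT`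
(polynomial time and polynomially bounded output) is closed under composition, pairing, case
distinction and, crucially, folds whose accumulator stays polynomially bounded (`PT.foldl`). The
whole algorithm is written with such folds. -/

/-! ### A structured language of stack programs and its compilation to Turing machines -/

namespace StackProg

open Turing Computability

/-- The stacks of the machines: the input stack, the main stack and three work stacks. -/
inductive Stk
  | inp | main | fst | snd | cnt
  deriving DecidableEq

instance : Fintype Stk :=
  ⟨{.inp, .main, .fst, .snd, .cnt}, fun k => by cases k <;> decide⟩

/-- The alphabet of each stack. -/
abbrev Alph : Stk → Type
  | .inp => Γ'
  | _ => Bool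

instance : ∀ k, Fintype (Alph k)
  | .inp => inferInstanceAs (Fintype Γ')
  | .main => inferInstanceAs (Fintype Bool)
  | .fst => inferInstanceAs (Fintype Bool)
  | .snd => inferInstanceAs (Fintype Bool)
  | .cnt => inferInstanceAs (Fintype Bool)

/-- The contents of all stacks. -/
abbrev Stacks := ∀ k, List (Alph k)

/-- Structured programs manipulating the stacks. -/
inductive Prog
  | skip : Prog
  | push (k : Stk) (a : Alph k) : Prog
  | seq (p q : Prog) : Prog
  | pop (k : Stk) (e : Prog) (c : Alph k → Prog) : Prog
  | loop (k : Stk) (go : Alph k → Bool) (c : Alph k → Prog) : Prog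

open Function (update)

/-- `Exec p s s' t`: the program `p` transforms `s` into `s'` in time `t`. -/
inductive Exec : Prog → Stacks → Stacks → ℕ → Prop
  | skip (s) : Exec .skip s s 1
  | push (k a s) : Exec (.push k a) s (update s k (a :: s k)) 1
  | seq {p q s s' s'' t t'} : Exec p s s' t → Exec q s' s'' t' → Exec (.seq p q) s s'' (t + t')
  | pop_nil {k e c s s' t} : s k = [] → Exec e s s' t → Exec (.pop k e c) s s' (t + 1)
  | pop_cons {k e c s s' t a l} : s k = a :: l → Exec (c a) (update s k l) s' t →
      Exec (.pop k e c) s s' (t + 1)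
  | loop_nil {k go c s} : s k = [] → Exec (.loop k go c) s s 1
  | loop_exit {k go c s a l} : s k = a :: l → go a = false →
      Exec (.loop k go c) s (update s k l) 1
  | loop_cons {k go c s s' s'' t t' a l} : s k = a :: l → go a = true →
      Exec (c a) (update s k l) s' t → Exec (.loop k go c) s' s'' t' →
      Exec (.loop k go c) s s'' (t + t' + 1)

/-- The labels of the compiled program. -/
def Lab : Prog → Type
  | .skip => Unit
  | .push _ _ => Unit
  | .seq p q => Lab p ⊕ Lab q
  | .pop k e c => Unit ⊕ (Lab e ⊕ Σ a : Alph k, Lab (c a))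
  | .loop k _ c => Unit ⊕ Σ a : Alph k, Lab (c a)

theorem finite_lab : ∀ p, Finite (Lab p)
  | .skip => inferInstanceAs (Finite Unit)
  | .push _ _ => inferInstanceAs (Finite Unit)
  | .seq p q =>
    have := finite_lab p
    have := finite_lab q
    inferInstanceAs (Finite (Lab p ⊕ Lab q))
  | .pop k e c =>
    have := finite_lab e
    have := fun a => finite_lab (c a)
    inferInstanceAs (Finite (Unit ⊕ (Lab e ⊕ Σ a : Alph k, Lab (c a))))
  | .loop k _ c =>
    have := fun a => finite_lab (c a)
    inferInstanceAs (Finite (Unit ⊕ Σ a : Alph k, Lab (c a)))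

/-- The label at which a compiled program starts. -/
def entry : ∀ p, Lab p
  | .skip => ()
  | .push _ _ => ()
  | .seq p _ => Sum.inl (entry p)
  | .pop _ _ _ => Sum.inl ()
  | .loop _ _ _ => Sum.inl ()

/-- The internal state of the machines remembers the last symbol read. -/
abbrev Mem := Option (Σ k, Alph k)

/-- The label selected by the symbol last read from the stack `k`. -/
def select {L : Type} (k : Stk) (e : L) (c : Alph k → L) : Mem → L
  | none => e
  | some ⟨k', a⟩ => if h : k' = k then c (h ▸ a) else e

/-- Reading the stack `k` and branching on the symbol read. -/
def readStmt {L : Type} (k : Stk) (e : L) (c : Alph k → L) : TM2.Stmt Alph L Mem :=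
  .pop k (fun _ o => o.map (fun a => ⟨k, a⟩)) (.goto (select k e c))

/-- The statements of the compiled program, with labels embedded by `emb`, which continues at the
label `exit`. -/
def stmt {L : Type} : ∀ (p : Prog), (Lab p → L) → L → Lab p → TM2.Stmt Alph L Mem
  | .skip, _, exit, _ => .goto fun _ => exit
  | .push k a, _, exit, _ => .push k (fun _ => a) (.goto fun _ => exit)
  | .seq p q, emb, exit, x =>
    match x with
    | .inl x => stmt p (fun y => emb (.inl y)) (emb (.inr (entry q))) x
    | .inr x => stmt q (fun y => emb (.inr y)) exit x
  | .pop k e c, emb, exit, x =>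
    match x with
    | .inl _ => readStmt k (emb (.inr (.inl (entry e))))
        (fun a => emb (.inr (.inr ⟨a, entry (c a)⟩)))
    | .inr (.inl x) => stmt e (fun y => emb (.inr (.inl y))) exit x
    | .inr (.inr ⟨a, x⟩) => stmt (c a) (fun y => emb (.inr (.inr ⟨a, y⟩))) exit x
  | .loop k go c, emb, exit, x =>
    match x with
    | .inl _ => readStmt k exit
        (fun a => if go a then emb (.inr ⟨a, entry (c a)⟩) else exit)
    | .inr ⟨a, x⟩ => stmt (c a) (fun y => emb (.inr ⟨a, y⟩)) (emb (.inl ())) x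

/-- `Steps M c c' t`: the machine `M` leads from `c` to `c'` in `t` steps. -/
def Steps {L : Type} (M : L → TM2.Stmt Alph L Mem) (c c' : TM2.Cfg Alph L Mem) (t : ℕ) : Prop :=
  (flip bind (TM2.step M))^[t] (some c) = some c'

theorem Steps.trans {L : Type} {M : L → TM2.Stmt Alph L Mem} {c c' c'' : TM2.Cfg Alph L Mem}
    {t t' : ℕ} (h : Steps M c c' t) (h' : Steps M c' c'' t') : Steps M c c'' (t + t') := by
  unfold Steps at *
  rw [Nat.add_comm, Function.iterate_add_apply, h, h']

theorem Steps.single {L : Type} {M : L → TM2.Stmt Alph L Mem} {l : L} {v : Mem} {s : Stacks}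
    {c : TM2.Cfg Alph L Mem} (h : TM2.stepAux (M l) v s = c) :
    Steps M ⟨some l, v, s⟩ c 1 := by
  simp [Steps, flip, h]

theorem stepAux_readStmt_nil {L : Type} {k : Stk} {e : L} {c : Alph k → L} {v : Mem}
    {s : Stacks} (h : s k = []) :
    TM2.stepAux (readStmt k e c) v s = ⟨some e, none, s⟩ := by
  have : update s k [] = s := by rw [← h, Function.update_eq_self]
  simp [readStmt, h, this, select]

theorem stepAux_readStmt_cons {L : Type} {k : Stk} {e : L} {c : Alph k → L} {v : Mem}
    {s : Stacks} {a : Alph k} {l : List (Alph k)} (h : s k = a :: l) :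
    TM2.stepAux (readStmt k e c) v s = ⟨some (c a), some ⟨k, a⟩, update s k l⟩ := by
  simp [readStmt, h, select]

/-- Induction on the execution. The label embedding `emb` and the label `exit` are arbitrary so that
the hypothesis passes to subprograms sitting inside larger ones. The memory may be arbitrary at the
start because every read overwrites it before branching on it. -/
theorem Exec.steps {p : Prog} {s s' : Stacks} {t : ℕ} (h : Exec p s s' t) {L : Type}
    (M : L → TM2.Stmt Alph L Mem) (emb : Lab p → L) (exit : L)
    (hM : ∀ x, M (emb x) = stmt p emb exit x) (v : Mem) :
    ∃ v', Steps M ⟨some (emb (entry p)), v, s⟩ ⟨some exit, v', s'⟩ t := by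
  induction h generalizing v exit with
  | skip s => exact ⟨v, Steps.single (by rw [hM]; simp [stmt])⟩
  | push k a s => exact ⟨v, Steps.single (by rw [hM]; simp [stmt])⟩
  | @seq p q s s' s'' t t' _ _ ih1 ih2 =>
    obtain ⟨v1, h1⟩ := ih1 (fun y => emb (.inl y)) (emb (.inr (entry q)))
      (fun x => hM (.inl x)) v
    obtain ⟨v2, h2⟩ := ih2 (fun y => emb (.inr y)) exit (fun x => hM (.inr x)) v1
    exact ⟨v2, h1.trans h2⟩
  | @pop_nil k e c s s' t hs _ ih =>
    obtain ⟨v1, h1⟩ := ih (fun y => emb (.inr (.inl y))) exit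
      (fun x => hM (.inr (.inl x))) none
    refine ⟨v1, ?_⟩
    rw [Nat.add_comm]
    refine Steps.trans (Steps.single ?_) h1
    rw [hM]
    exact stepAux_readStmt_nil hs
  | @pop_cons k e c s s' t a l hs _ ih =>
    obtain ⟨v1, h1⟩ := ih (fun y => emb (.inr (.inr ⟨a, y⟩))) exit
      (fun x => hM (.inr (.inr ⟨a, x⟩))) (some ⟨k, a⟩)
    refine ⟨v1, ?_⟩
    rw [Nat.add_comm]
    refine Steps.trans (Steps.single ?_) h1
    rw [hM]
    exact stepAux_readStmt_cons hs
  | @loop_nil k go c s hs =>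
    refine ⟨none, Steps.single ?_⟩
    rw [hM]
    exact stepAux_readStmt_nil hs
  | @loop_exit k go c s a l hs hg =>
    refine ⟨some ⟨k, a⟩, Steps.single ?_⟩
    rw [hM]
    exact (stepAux_readStmt_cons hs).trans (by simp [hg])
  | @loop_cons k go c s s' s'' t t' a l hs hg _ _ ih1 ih2 =>
    obtain ⟨v1, h1⟩ := ih1 (fun y => emb (.inr ⟨a, y⟩)) (emb (.inl ()))
      (fun x => hM (.inr ⟨a, x⟩)) (some ⟨k, a⟩)
    obtain ⟨v2, h2⟩ := ih2 emb exit hM v1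
    refine ⟨v2, ?_⟩
    rw [Nat.add_comm]
    refine Steps.trans (Steps.single ?_) (h1.trans h2)
    rw [hM]
    exact (stepAux_readStmt_cons hs).trans (by simp [hg])

/-- The Turing machine running the program `p`, with output on the main stack. -/
noncomputable def machine (p : Prog) : FinTM2 where
  K := Stk
  kDecidableEq := inferInstance
  kFin := inferInstance
  k₀ := .inp
  k₁ := .main
  Γ := Alph
  Λ := Option (Lab p)
  main := some (entry p)
  ΛFin := have := finite_lab p; Fintype.ofFinite _
  σ := Mem
  initialState := none
  σFin := inferInstance
  Γk₀Fin := inferInstance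
  m
    | none => .load (fun _ => none) .halt
    | some x => stmt p some none x

/-- The stacks with the given contents. -/
def st (i : List Γ') (m f s c : List Bool) : Stacks
  | .inp => i
  | .main => m
  | .fst => f
  | .snd => s
  | .cnt => c

section
variable (i : List Γ') (m f s c : List Bool)
@[simp] theorem st_inp : st i m f s c .inp = i := rfl
@[simp] theorem st_main : st i m f s c .main = m := rfl
@[simp] theorem st_fst : st i m f s c .fst = f := rfl
@[simp] theorem st_snd : st i m f s c .snd = s := rfl
@[simp] theorem st_cnt : st i m f s c .cnt = c := rfl
@[simp] theorem update_inp (x : List (Alph .inp)) :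
    update (st i m f s c) .inp x = st x m f s c := by
  ext k : 1; cases k <;> rfl
@[simp] theorem update_main (x : List (Alph .main)) :
    update (st i m f s c) .main x = st i x f s c := by
  ext k : 1; cases k <;> rfl
@[simp] theorem update_fst (x : List (Alph .fst)) :
    update (st i m f s c) .fst x = st i m x s c := by
  ext k : 1; cases k <;> rfl
@[simp] theorem update_snd (x : List (Alph .snd)) :
    update (st i m f s c) .snd x = st i m f x c := by
  ext k : 1; cases k <;> rfl
@[simp] theorem update_cnt (x : List (Alph .cnt)) :
    update (st i m f s c) .cnt x = st i m f s x := by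
  ext k : 1; cases k <;> rfl
end

/-- A program that decides `P` in polynomial time gives rise to a Turing machine doing so. -/
theorem solvableInPolyTime_of_exec {α : Type} {enc : α → List Γ'} {P : α → Prop} (p : Prog)
    (q : Polynomial ℕ)
    (h : ∀ x, ∃ b : Bool, (b = true ↔ P x) ∧
      ∃ t ≤ q.eval (enc x).length, Exec p (st (enc x) [] [] [] []) (st [] [b] [] [] []) t) :
    SolvableInPolyTime enc P := by
  classical
  refine ⟨{ tm := machine p, inputAlphabet := Equiv.refl _, outputAlphabet := Equiv.refl _,
            time := q + 1, outputsFun := fun x => ?_ }⟩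
  refine Classical.choice ?_
  obtain ⟨b, hb, t, ht, he⟩ := h x
  obtain ⟨v, hs⟩ := he.steps (machine p).m some none (fun _ => rfl) none
  have hd : decide (P x) = b := by
    by_cases hP : P x
    · simp [hP, hb.2 hP]
    · have : b ≠ true := fun hh => hP (hb.1 hh)
      simp [hP, this]
  -- The one extra step erases the memory: a halting configuration must carry the initial memory
  -- `none`, whereas `v` is unknown.
  have hs2 : Steps (machine p).m ⟨some none, v, st [] [b] [] [] []⟩
      ⟨none, none, st [] [b] [] [] []⟩ 1 := Steps.single rfl
  refine ⟨⟨⟨t + 1, ?_⟩, by simpa using ht⟩⟩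
  have hin : initList (machine p) (List.map (Equiv.refl Γ').invFun (enc x)) =
      ⟨some (some (entry p)), none, st (enc x) [] [] [] []⟩ := by
    unfold initList
    congr 1
    ext k : 1
    cases k
    · change List.map (fun x => x) (enc x) = _
      simp
    all_goals rfl
  have hout : haltList (machine p)
      (List.map (Equiv.refl Bool).invFun (encodeBool (decide (P x)))) =
      ⟨none, none, st [] [b] [] [] []⟩ := by
    rw [hd]
    unfold haltList
    congr 1
    ext k : 1
    cases k <;> rfl
  change (flip bind (TM2.step (machine p).m))^[t + 1] (some (initList (machine p) _)) =
    some (haltList (machine p) _)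
  refine (congrArg (fun c => (flip bind (TM2.step (machine p).m))^[t + 1] (some c)) hin).trans ?_
  have h3 := hs.trans hs2
  unfold Steps at h3
  exact h3.trans (congrArg some hout.symm)

end StackProg

/-! ### Binary trees on the main stack -/

namespace StackProg

open Turing Computability

/-- Binary trees, the data on which the machines operate. -/
inductive BT
  | nil : BT
  | cons (a b : BT) : BT

namespace BT

/-- The prefix notation of a binary tree. -/
def enc : BT → List Bool
  | nil => [false]
  | cons a b => true :: (enc a ++ enc b)

/-- The number of nodes of a binary tree. -/
def size : BT → ℕ
  | nil => 1
  | cons a b => size a + size b + 1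

theorem length_enc (x : BT) : x.enc.length = x.size := by
  induction x with
  | nil => rfl
  | cons a b iha ihb => simp [enc, size, iha, ihb]

theorem size_pos (x : BT) : 0 < x.size := by
  cases x <;> simp [size]

end BT

/-- `Runs p s s' T`: the program `p` transforms `s` into `s'` in time at most `T`. -/
def Runs (p : Prog) (s s' : Stacks) (T : ℕ) : Prop :=
  ∃ t ≤ T, Exec p s s' t

theorem Runs.mono {p : Prog} {s s' : Stacks} {T T' : ℕ} (h : Runs p s s' T) (hT : T ≤ T') :
    Runs p s s' T' := by
  obtain ⟨t, ht, he⟩ := h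
  exact ⟨t, ht.trans hT, he⟩

theorem Runs.seq {p q : Prog} {s s' s'' : Stacks} {T T' : ℕ} (h : Runs p s s' T)
    (h' : Runs q s' s'' T') : Runs (.seq p q) s s'' (T + T') := by
  obtain ⟨t, ht, he⟩ := h
  obtain ⟨t', ht', he'⟩ := h'
  exact ⟨t + t', by omega, .seq he he'⟩

theorem Runs.skip (s : Stacks) : Runs .skip s s 1 := ⟨1, le_rfl, .skip s⟩

theorem Runs.push (k : Stk) (a : Alph k) (s : Stacks) :
    Runs (.push k a) s (Function.update s k (a :: s k)) 1 := ⟨1, le_rfl, .push k a s⟩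

theorem Runs.pop_cons {k : Stk} {e : Prog} {c : Alph k → Prog} {s s' : Stacks} {T : ℕ}
    {a : Alph k} {l : List (Alph k)} (hs : s k = a :: l)
    (h : Runs (c a) (Function.update s k l) s' T) : Runs (.pop k e c) s s' (T + 1) := by
  obtain ⟨t, ht, he⟩ := h
  exact ⟨t + 1, by omega, .pop_cons hs he⟩

theorem Runs.loop_nil {k : Stk} {go : Alph k → Bool} {c : Alph k → Prog} {s : Stacks}
    (hs : s k = []) : Runs (.loop k go c) s s 1 := ⟨1, le_rfl, .loop_nil hs⟩

theorem Runs.loop_exit {k : Stk} {go : Alph k → Bool} {c : Alph k → Prog} {s : Stacks}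
    {a : Alph k} {l : List (Alph k)} (hs : s k = a :: l) (hg : go a = false) :
    Runs (.loop k go c) s (Function.update s k l) 1 := ⟨1, le_rfl, .loop_exit hs hg⟩

theorem Runs.loop_cons {k : Stk} {go : Alph k → Bool} {c : Alph k → Prog} {s s' s'' : Stacks}
    {T T' : ℕ} {a : Alph k} {l : List (Alph k)} (hs : s k = a :: l) (hg : go a = true)
    (h : Runs (c a) (Function.update s k l) s' T) (h' : Runs (.loop k go c) s' s'' T') :
    Runs (.loop k go c) s s'' (T + T' + 1) := by
  obtain ⟨t, ht, he⟩ := h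
  obtain ⟨t', ht', he'⟩ := h'
  exact ⟨t + t' + 1, by omega, .loop_cons hs hg he he'⟩

/-- The configuration of stacks with contents `m` of the main stack, `w` of the work stack named
by `b`, and `o` of the other one. -/
def stw (b : Bool) (m w o c : List Bool) : Stacks :=
  cond b (st [] m w o c) (st [] m o w c)

/-- Push onto the work stack named by `b`. -/
def pushWork : Bool → Bool → Prog
  | true, x => .push .fst x
  | false, x => .push .snd x

theorem runs_pushWork (b x : Bool) (m w o c : List Bool) :
    Runs (pushWork b x) (stw b m w o c) (stw b m (x :: w) o c) 1 := by
  cases b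
  · simpa [stw, pushWork] using Runs.push .snd x (st [] m o w c)
  · simpa [stw, pushWork] using Runs.push .fst x (st [] m w o c)

/-- The loop moving trees from the main stack to a work stack, as many as the counter says. -/
def moveLoop (b : Bool) : Prog :=
  .loop .cnt (fun _ => true) fun _ => .pop .main .skip fun (x : Bool) =>
    .seq (pushWork b x) (cond x (.seq (.push .cnt true) (.push .cnt true)) .skip)

/-- Move the topmost tree from the main stack to a work stack. -/
def move (b : Bool) : Prog :=
  .seq (.push .cnt true) (moveLoop b)

theorem stw_main (b : Bool) (m w o c : List Bool) : stw b m w o c .main = m := by cases b <;> rfl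
theorem stw_cnt (b : Bool) (m w o c : List Bool) : stw b m w o c .cnt = c := by cases b <;> rfl
theorem update_stw_main (b : Bool) (m w o c : List Bool) (x : List (Alph .main)) :
    Function.update (stw b m w o c) .main x = stw b x w o c := by cases b <;> simp [stw]
theorem update_stw_cnt (b : Bool) (m w o c : List Bool) (x : List (Alph .cnt)) :
    Function.update (stw b m w o c) .cnt x = stw b m w o x := by cases b <;> simp [stw]

/-- The counter stack holds one mark per subtree still to be moved: every node read consumes a mark,
and an inner node adds two for its children. The loop therefore stops exactly at the end of the
prefix word. Stating the claim relative to an arbitrary continuation `h` lets the two subtrees be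
handled one after the other in the induction. -/
theorem runs_moveLoop (b : Bool) (x : BT) {rest w o c : List Bool} {s' : Stacks} {T : ℕ}
    (h : Runs (moveLoop b) (stw b rest (x.enc.reverse ++ w) o c) s' T) :
    Runs (moveLoop b) (stw b (x.enc ++ rest) w o (true :: c)) s' (T + 5 * x.size) := by
  induction x generalizing rest w c T with
  | nil =>
    refine Runs.mono (Runs.loop_cons (stw_cnt _ _ _ _ _) rfl
      (Runs.pop_cons (a := false) (l := rest) ?_ (Runs.seq (s' := stw b rest (false :: w) o c) ?_
        (Runs.skip _))) h) (?_ : (1 + 1 + 1) + T + 1 ≤ _)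
    · rw [update_stw_cnt, stw_main]; rfl
    · rw [update_stw_cnt, update_stw_main]; exact runs_pushWork _ _ _ _ _ _
    · simp only [BT.size]; omega
  | cons x y ihx ihy =>
    have h1 := ihx (w := true :: w) (rest := y.enc ++ rest) (ihy (by simpa [BT.enc] using h))
    refine Runs.mono (Runs.loop_cons (stw_cnt _ _ _ _ _) rfl
      (Runs.pop_cons (a := true) (l := x.enc ++ (y.enc ++ rest)) ?_
        (Runs.seq (s' := stw b (x.enc ++ (y.enc ++ rest)) (true :: w) o c)
        (T' := 1 + 1) ?_ ?_)) h1)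
        (?_ : (1 + (1 + 1) + 1) + _ + 1 ≤ _)
    · rw [update_stw_cnt, stw_main]; simp [BT.enc]
    · rw [update_stw_cnt, update_stw_main]; exact runs_pushWork _ _ _ _ _ _
    · refine Runs.seq (Runs.push _ _ _) ?_
      have := Runs.push .cnt true (stw b (x.enc ++ (y.enc ++ rest)) (true :: w) o (true :: c))
      rw [update_stw_cnt, stw_cnt] at this ⊢
      exact this
    · simp only [BT.size]; omega

theorem runs_move (b : Bool) (x : BT) (rest w o : List Bool) :
    Runs (move b) (stw b (x.enc ++ rest) w o []) (stw b rest (x.enc.reverse ++ w) o [])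
      (5 * x.size + 2) := by
  refine Runs.mono (Runs.seq (Runs.push _ _ _) ?_) (?_ : 1 + (1 + 5 * x.size) ≤ _)
  · rw [update_stw_cnt, stw_cnt]
    exact runs_moveLoop b x (Runs.loop_nil (stw_cnt _ _ _ _ _))
  · omega

theorem runs_move_fst (x : BT) (rest f s : List Bool) :
    Runs (move true) (st [] (x.enc ++ rest) f s []) (st [] rest (x.enc.reverse ++ f) s [])
      (5 * x.size + 2) := runs_move true x rest f s

theorem runs_move_snd (x : BT) (rest f s : List Bool) :
    Runs (move false) (st [] (x.enc ++ rest) f s []) (st [] rest f (x.enc.reverse ++ s) [])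
      (5 * x.size + 2) := runs_move false x rest s f

/-- Move the contents of the first work stack back. -/
def drainFst : Prog := .loop .fst (fun _ => true) fun (x : Bool) => .push .main x

/-- Move the contents of the second work stack back. -/
def drainSnd : Prog := .loop .snd (fun _ => true) fun (x : Bool) => .push .main x

/-- Move the contents of the second work stack to the first. -/
def sndToFst : Prog := .loop .snd (fun _ => true) fun (x : Bool) => .push .fst x

/-- Move the contents of the first work stack back, keeping a copy on the second. -/
def drainCopy : Prog :=
  .loop .fst (fun _ => true) fun (x : Bool) => .seq (.push .main x) (.push .snd x)

/-- Empty the first work stack. -/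
def clearFst : Prog := .loop .fst (fun _ => true) fun _ => .skip

theorem runs_drainFst (m f s c : List Bool) :
    Runs drainFst (st [] m f s c) (st [] (f.reverse ++ m) [] s c) (2 * f.length + 1) := by
  induction f generalizing m with
  | nil => exact Runs.loop_nil rfl
  | cons x f ih =>
    have h := ih (x :: m)
    rw [List.reverse_cons, List.append_assoc]
    refine Runs.mono (Runs.loop_cons rfl rfl (Runs.push _ _ _) (by simpa [drainFst] using h)) ?_
    simp only [List.length_cons]; omega

theorem runs_drainSnd (m f s c : List Bool) :
    Runs drainSnd (st [] m f s c) (st [] (s.reverse ++ m) f [] c) (2 * s.length + 1) := by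
  induction s generalizing m with
  | nil => exact Runs.loop_nil rfl
  | cons x s ih =>
    have h := ih (x :: m)
    rw [List.reverse_cons, List.append_assoc]
    refine Runs.mono (Runs.loop_cons rfl rfl (Runs.push _ _ _) (by simpa [drainSnd] using h)) ?_
    simp only [List.length_cons]; omega

theorem runs_sndToFst (m f s c : List Bool) :
    Runs sndToFst (st [] m f s c) (st [] m (s.reverse ++ f) [] c) (2 * s.length + 1) := by
  induction s generalizing f with
  | nil => exact Runs.loop_nil rfl
  | cons x s ih =>
    have h := ih (x :: f)
    rw [List.reverse_cons, List.append_assoc]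
    refine Runs.mono (Runs.loop_cons rfl rfl (Runs.push _ _ _) (by simpa [sndToFst] using h)) ?_
    simp only [List.length_cons]; omega

theorem runs_drainCopy (m f s c : List Bool) :
    Runs drainCopy (st [] m f s c) (st [] (f.reverse ++ m) [] (f.reverse ++ s) c)
      (3 * f.length + 1) := by
  induction f generalizing m s with
  | nil => exact Runs.loop_nil rfl
  | cons x f ih =>
    have h := ih (x :: m) (x :: s)
    rw [List.reverse_cons, List.append_assoc, List.append_assoc]
    refine Runs.mono (Runs.loop_cons rfl rfl (Runs.seq (Runs.push _ _ _) (Runs.push _ _ _))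
      (by simpa [drainCopy] using h)) ?_
    simp only [List.length_cons]; omega

theorem runs_clearFst (m f s c : List Bool) :
    Runs clearFst (st [] m f s c) (st [] m [] s c) (2 * f.length + 1) := by
  induction f with
  | nil => exact Runs.loop_nil rfl
  | cons x f ih =>
    refine Runs.mono (Runs.loop_cons rfl rfl (Runs.skip _) (by simpa [clearFst] using ih)) ?_
    simp only [List.length_cons]; omega

/-! ### Programs acting on the topmost trees of the main stack -/

/-- The word representing a sequence of trees. -/
def encs : List BT → List Bool
  | [] => []
  | x :: l => x.enc ++ encs l

theorem encs_append (l l' : List BT) : encs (l ++ l') = encs l ++ encs l' := by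
  induction l with
  | nil => rfl
  | cons x l ih => simp [encs, ih]

/-- `TRuns p xs ys T`: the program `p` replaces the trees `xs` on top of the main stack by the
trees `ys` in time at most `T`. -/
def TRuns (p : Prog) (xs ys : List BT) (T : ℕ) : Prop :=
  ∀ rest, Runs p (st [] (encs xs ++ rest) [] [] []) (st [] (encs ys ++ rest) [] [] []) T

theorem TRuns.mono {p : Prog} {xs ys : List BT} {T T' : ℕ} (h : TRuns p xs ys T) (hT : T ≤ T') :
    TRuns p xs ys T' := fun rest => (h rest).mono hT

theorem TRuns.seq {p q : Prog} {xs ys zs : List BT} {T T' : ℕ} (h : TRuns p xs ys T)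
    (h' : TRuns q ys zs T') : TRuns (.seq p q) xs zs (T + T') :=
  fun rest => (h rest).seq (h' rest)

theorem TRuns.frame {p : Prog} {xs ys : List BT} {T : ℕ} (h : TRuns p xs ys T) (zs : List BT) :
    TRuns p (xs ++ zs) (ys ++ zs) T := fun rest => by
  simpa [encs_append] using h (encs zs ++ rest)

theorem tRuns_nil : TRuns (.push .main false) [] [.nil] 1 := fun rest => by
  simpa [encs, BT.enc] using Runs.push .main false (st [] rest [] [] [])

theorem tRuns_cons (a b : BT) : TRuns (.push .main true) [a, b] [.cons a b] 1 := fun rest => by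
  simpa [encs, BT.enc] using Runs.push .main true (st [] (a.enc ++ (b.enc ++ rest)) [] [] [])

theorem tRuns_skip (xs : List BT) : TRuns .skip xs xs 1 := fun _ => Runs.skip _

/-- Branch on the shape of the topmost tree, removing its root. -/
def caseTree (p q : Prog) : Prog :=
  .pop .main .skip fun (x : Bool) => cond x p q

theorem tRuns_case_nil {p q : Prog} {xs ys : List BT} {T : ℕ} (h : TRuns q xs ys T) :
    TRuns (caseTree p q) (.nil :: xs) ys (T + 1) := fun rest =>
  Runs.pop_cons (a := false) (l := encs xs ++ rest) rfl (by simpa using h rest)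

theorem tRuns_case_cons {p q : Prog} {a b : BT} {xs ys : List BT} {T : ℕ}
    (h : TRuns p (a :: b :: xs) ys T) : TRuns (caseTree p q) (.cons a b :: xs) ys (T + 1) :=
  fun rest =>
  Runs.pop_cons (a := true) (l := encs (a :: b :: xs) ++ rest) (by simp [encs, BT.enc])
    (by simpa using h rest)

/-- Loop as long as the topmost tree is not a leaf, removing its root each time. -/
def whileCons (p : Prog) : Prog :=
  .loop .main (fun (x : Bool) => x) fun _ => p

theorem tRuns_while_nil {p : Prog} {xs : List BT} : TRuns (whileCons p) (.nil :: xs) xs 1 :=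
  fun rest => by
  have := Runs.loop_exit (k := .main) (go := fun (x : Bool) => x) (c := fun _ => p)
    (s := st [] (encs (.nil :: xs) ++ rest) [] [] []) (a := false) (l := encs xs ++ rest) rfl rfl
  simpa [whileCons] using this

theorem tRuns_while_cons {p : Prog} {a b : BT} {xs ys zs : List BT} {T T' : ℕ}
    (h : TRuns p (a :: b :: xs) ys T) (h' : TRuns (whileCons p) ys zs T') :
    TRuns (whileCons p) (.cons a b :: xs) zs (T + T' + 1) := fun rest =>
  Runs.loop_cons (a := true) (l := encs (a :: b :: xs) ++ rest) (by simp [encs, BT.enc]) rfl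
    (by simpa using h rest) (h' rest)

/-- Exchange the two topmost trees. -/
def swap : Prog := .seq (move true) (.seq (move false) (.seq drainFst drainSnd))

/-- Moving a tree to a work stack reverses its word and draining reverses it back; with the two
trees on different work stacks, the one drained first ends up underneath. -/
theorem tRuns_swap (a b : BT) : TRuns swap [a, b] [b, a] (7 * (a.size + b.size) + 6) :=
  fun rest => by
  have h1 := runs_move_fst a (b.enc ++ rest) [] []
  have h2 := runs_move_snd b rest (a.enc.reverse ++ []) []
  have h3 := runs_drainFst rest (a.enc.reverse ++ []) (b.enc.reverse ++ []) []
  have h4 := runs_drainSnd ((a.enc.reverse ++ []).reverse ++ rest) [] (b.enc.reverse ++ []) []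
  have h := h1.seq (h2.seq (h3.seq h4))
  simp only [List.append_nil, List.reverse_reverse, List.length_reverse, BT.length_enc] at h
  simp only [encs, List.append_nil, List.append_assoc]
  exact h.mono (by omega)

/-- Exchange the second and the third tree. -/
def swapUnder : Prog :=
  .seq (move true) (.seq (move false) (.seq (move true) (.seq drainSnd drainFst)))

theorem tRuns_swapUnder (a b c : BT) :
    TRuns swapUnder [a, b, c] [a, c, b] (7 * (a.size + b.size + c.size) + 8) := fun rest => by
  have h1 := runs_move_fst a (b.enc ++ (c.enc ++ rest)) [] []
  have h2 := runs_move_snd b (c.enc ++ rest) (a.enc.reverse ++ []) []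
  have h3 := runs_move_fst c rest (a.enc.reverse ++ []) (b.enc.reverse ++ [])
  have h4 := runs_drainSnd rest (c.enc.reverse ++ (a.enc.reverse ++ [])) (b.enc.reverse ++ []) []
  have h5 := runs_drainFst ((b.enc.reverse ++ []).reverse ++ rest)
    (c.enc.reverse ++ (a.enc.reverse ++ [])) [] []
  have h := h1.seq (h2.seq (h3.seq (h4.seq h5)))
  simp only [List.append_nil, List.reverse_append, List.reverse_reverse, List.length_append,
    List.length_reverse, BT.length_enc, List.append_assoc] at h
  simp only [encs, List.append_nil, List.append_assoc]
  exact h.mono (by omega)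

/-- Remove the topmost tree. -/
def drop : Prog := .seq (move true) clearFst

theorem tRuns_drop (a : BT) : TRuns drop [a] [] (7 * a.size + 3) := fun rest => by
  have h := (runs_move_fst a rest [] []).seq (runs_clearFst rest (a.enc.reverse ++ []) [] [])
  simp only [List.append_nil, List.length_reverse, BT.length_enc] at h
  simp only [encs, List.append_nil, List.nil_append]
  exact h.mono (by omega)

/-- Duplicate the topmost tree. -/
def dup : Prog := .seq (move true) (.seq drainCopy (.seq sndToFst drainFst))

theorem tRuns_dup (a : BT) : TRuns dup [a] [a, a] (12 * a.size + 5) := fun rest => by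
  have h1 := runs_move_fst a rest [] []
  have h2 := runs_drainCopy rest (a.enc.reverse ++ []) [] []
  have h3 := runs_sndToFst ((a.enc.reverse ++ []).reverse ++ rest) []
    ((a.enc.reverse ++ []).reverse ++ []) []
  have h4 := runs_drainFst ((a.enc.reverse ++ []).reverse ++ rest)
    (((a.enc.reverse ++ []).reverse ++ []).reverse ++ []) [] []
  have h := h1.seq (h2.seq (h3.seq h4))
  simp only [List.append_nil, List.reverse_reverse, List.length_reverse, BT.length_enc] at h
  simp only [encs, List.append_nil, List.append_assoc]
  exact h.mono (by omega)

end StackProg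

/-! ### Functions computable in polynomial time on represented data -/

namespace StackProg

open Turing Computability

/-- A representation of the elements of a type by binary trees. -/
class Rep (α : Type) where
  /-- the tree representing an element -/
  rep : α → BT

open StackProg.Rep (rep)

/-- The size of the representation of an element. -/
def sz {α : Type} [Rep α] (x : α) : ℕ := (rep x).size

theorem sz_pos {α : Type} [Rep α] (x : α) : 0 < sz x := BT.size_pos _


instance : Rep Bool := ⟨fun b => cond b (.cons .nil .nil) .nil⟩

instance {α β : Type} [Rep α] [Rep β] : Rep (α × β) := ⟨fun p => .cons (rep p.1) (rep p.2)⟩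

/-- The tree representing a list. -/
def repList {α : Type} [Rep α] : List α → BT
  | [] => .nil
  | a :: l => .cons (rep a) (repList l)

instance {α : Type} [Rep α] : Rep (List α) := ⟨repList⟩

section
variable {α β γ σ : Type} [Rep α] [Rep β] [Rep γ] [Rep σ]

@[simp] theorem rep_false : rep false = .nil := rfl
@[simp] theorem rep_true : rep true = .cons .nil .nil := rfl
@[simp] theorem rep_pair (a : α) (b : β) : rep (a, b) = .cons (rep a) (rep b) := rfl
@[simp] theorem rep_list_nil : rep ([] : List α) = .nil := rfl
@[simp] theorem rep_list_cons (a : α) (l : List α) : rep (a :: l) = .cons (rep a) (rep l) := rfl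

@[simp] theorem sz_pair (a : α) (b : β) : sz (a, b) = sz a + sz b + 1 := rfl
@[simp] theorem sz_nil : sz ([] : List α) = 1 := rfl
@[simp] theorem sz_cons (a : α) (l : List α) : sz (a :: l) = sz a + sz l + 1 := rfl
theorem sz_bool_le (b : Bool) : sz b ≤ 3 := by cases b <;> simp [sz, BT.size]

theorem length_le_sz (l : List α) : l.length + 1 ≤ sz l := by
  induction l with
  | nil => simp
  | cons a l ih => simp only [List.length_cons, sz_cons]; omega

theorem sz_le_of_mem {a : α} {l : List α} (h : a ∈ l) : sz a ≤ sz l := by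
  induction l with
  | nil => simp at h
  | cons b l ih =>
    rw [sz_cons]
    rcases List.mem_cons.1 h with rfl | h
    · omega
    · have := ih h; omega

theorem sz_le_of_length_le {l : List α} {n m : ℕ} (hl : l.length ≤ n) (h : ∀ a ∈ l, sz a ≤ m) :
    sz l ≤ n * (m + 1) + 1 := by
  induction l generalizing n with
  | nil => simp
  | cons a l ih =>
    obtain ⟨n, rfl⟩ : ∃ k, n = k + 1 := ⟨n - 1, by simp at hl; omega⟩
    have h1 := ih (n := n) (by simpa using hl) (fun b hb => h b (List.mem_cons_of_mem _ hb))
    have h2 := h a (by simp)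
    rw [sz_cons, Nat.succ_mul]
    omega

theorem sz_append (l l' : List α) : sz (l ++ l') + 1 = sz l + sz l' := by
  induction l with
  | nil => simp; omega
  | cons a l ih => simp only [List.cons_append, sz_cons]; omega

end

/-! #### Folds building lists -/

theorem foldl_cons_eq {γ : Type} (l l' : List γ) :
    l.foldl (fun r a => a :: r) l' = l.reverse ++ l' := by
  induction l generalizing l' with
  | nil => rfl
  | cons a l ih => simp [ih]

theorem foldl_map_cons_eq {γ δ : Type} (g : γ → δ) (l : List γ) (l' : List δ) :
    l.foldl (fun r a => g a :: r) l' = (l.map g).reverse ++ l' := by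
  induction l generalizing l' with
  | nil => rfl
  | cons a l ih => simp [ih]

/-- One step of zipping two lists. -/
def zipStep {γ δ : Type} (r : List δ × List (γ × δ)) (a : γ) : List δ × List (γ × δ) :=
  match r.1 with
  | [] => r
  | b :: t => (t, (a, b) :: r.2)

theorem foldl_zipStep {γ δ : Type} (l : List γ) (l' : List δ) (r : List (γ × δ)) :
    (l.foldl zipStep (l', r)).2 = (l.zip l').reverse ++ r := by
  induction l generalizing l' r with
  | nil => rfl
  | cons a l ih =>
    cases l' with
    | nil =>
      have := ih [] r
      simpa [zipStep] using this
    | cons b l' =>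
      have := ih l' ((a, b) :: r)
      simpa [zipStep] using this

/-! #### Polynomially bounded functions -/

theorem eval_mono (q : Polynomial ℕ) {m n : ℕ} (h : m ≤ n) : q.eval m ≤ q.eval n := by
  simp only [Polynomial.eval_eq_sum, Polynomial.sum]
  gcongr

/-- The function `t` is bounded by a polynomial in the size of its argument. -/
def PB {α : Type} [Rep α] (t : α → ℕ) : Prop := ∃ q : Polynomial ℕ, ∀ x, t x ≤ q.eval (sz x)

/-- The function `f` is computable in polynomial time. -/
def PT {α β : Type} [Rep α] [Rep β] (f : α → β) : Prop :=
  PB (fun x => sz (f x)) ∧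
    ∃ (p : Prog) (t : α → ℕ), PB t ∧ ∀ x, TRuns p [rep x] [rep (f x)] (t x)

section
variable {α β γ δ σ : Type} [Rep α] [Rep β] [Rep γ] [Rep δ] [Rep σ]

theorem PB.mono {t t' : α → ℕ} (h : PB t) (h' : ∀ x, t' x ≤ t x) : PB t' := by
  obtain ⟨q, hq⟩ := h
  exact ⟨q, fun x => (h' x).trans (hq x)⟩

theorem PB.const (n : ℕ) : PB (fun _ : α => n) := ⟨Polynomial.C n, fun x => by simp⟩

theorem PB.sz : PB (fun x : α => sz x) := ⟨Polynomial.X, fun x => by simp⟩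

theorem PB.add {t t' : α → ℕ} (h : PB t) (h' : PB t') : PB (fun x => t x + t' x) := by
  obtain ⟨q, hq⟩ := h
  obtain ⟨q', hq'⟩ := h'
  exact ⟨q + q', fun x => by rw [Polynomial.eval_add]; exact add_le_add (hq x) (hq' x)⟩

theorem PB.mul {t t' : α → ℕ} (h : PB t) (h' : PB t') : PB (fun x => t x * t' x) := by
  obtain ⟨q, hq⟩ := h
  obtain ⟨q', hq'⟩ := h'
  exact ⟨q * q', fun x => by rw [Polynomial.eval_mul]; exact Nat.mul_le_mul (hq x) (hq' x)⟩

theorem PB.eval (q : Polynomial ℕ) {t : α → ℕ} (h : PB t) : PB (fun x => q.eval (t x)) := by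
  obtain ⟨q', hq'⟩ := h
  exact ⟨q.comp q', fun x => by rw [Polynomial.eval_comp]; exact eval_mono q (hq' x)⟩

theorem PB.comp {t : β → ℕ} {f : α → β} (h : PB t) (hf : PB (fun x => StackProg.sz (f x))) :
    PB (fun x => t (f x)) := by
  obtain ⟨q, hq⟩ := h
  exact (hf.eval q).mono fun x => hq _

theorem PT.size {f : α → β} (h : PT f) : PB (fun x => sz (f x)) := h.1

/-! #### Basic closure properties -/

theorem PT.id : PT (fun x : α => x) :=
  ⟨PB.sz, .skip, fun _ => 1, PB.const 1, fun _ => tRuns_skip _⟩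

/-- The size bound contained in `PT` is needed here: the running time of the second program is
polynomial in the size of the intermediate value. -/
theorem PT.comp {g : β → γ} {f : α → β} (hg : PT g) (hf : PT f) : PT (fun x => g (f x)) := by
  obtain ⟨hgs, p, t, ht, hp⟩ := hg
  obtain ⟨hfs, p', t', ht', hp'⟩ := hf
  exact ⟨hgs.comp hfs, .seq p' p, _, ht'.add (ht.comp hfs), fun x => (hp' x).seq (hp (f x))⟩

/-- Push a tree onto the main stack. -/
def pushTree : BT → Prog
  | .nil => .push .main false
  | .cons a b => .seq (pushTree b) (.seq (pushTree a) (.push .main true))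

theorem tRuns_pushTree (x : BT) : TRuns (pushTree x) [] [x] x.size := by
  induction x with
  | nil => exact tRuns_nil
  | cons a b iha ihb =>
    exact (ihb.seq ((iha.frame [b]).seq (tRuns_cons a b))).mono (by simp only [BT.size]; omega)

theorem PT.const (c : β) : PT (fun _ : α => c) := by
  refine ⟨PB.const _, .seq drop (pushTree (rep c)), fun x => (7 * sz x + 3) + sz c,
    (((PB.const 7).mul PB.sz).add (PB.const 3)).add (PB.const _), fun x => ?_⟩
  exact (tRuns_drop (rep x)).seq (tRuns_pushTree (rep c))

theorem PT.pair {f : α → β} {g : α → γ} (hf : PT f) (hg : PT g) : PT (fun x => (f x, g x)) := by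
  obtain ⟨hfs, p, t, ht, hp⟩ := hf
  obtain ⟨hgs, p', t', ht', hp'⟩ := hg
  refine ⟨(hfs.add hgs).add (PB.const 1), .seq dup (.seq p (.seq swap (.seq p' (.seq swap
    (.push .main true))))), fun x => (12 * sz x + 5) + (t x + ((7 * (sz (f x) + sz x) + 6) +
    (t' x + ((7 * (sz (g x) + sz (f x)) + 6) + 1)))), ?_, fun x => ?_⟩
  · exact (((PB.const 12).mul PB.sz).add (PB.const 5)).add (ht.add ((((PB.const 7).mul
      (hfs.add PB.sz)).add (PB.const 6)).add (ht'.add ((((PB.const 7).mul (hgs.add hfs)).add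
      (PB.const 6)).add (PB.const 1)))))
  · exact (tRuns_dup (rep x)).seq (((hp x).frame [rep x]).seq ((tRuns_swap _ _).seq
      (((hp' x).frame [rep (f x)]).seq ((tRuns_swap _ _).seq (tRuns_cons _ _)))))

theorem PT.fst : PT (fun p : α × β => p.1) := by
  refine ⟨PB.sz.mono fun p => ?_, caseTree (.seq swap drop) .skip,
    fun p => 14 * sz p + 10, ((PB.const 14).mul PB.sz).add (PB.const 10), fun p => ?_⟩
  · obtain ⟨a, b⟩ := p; simp only [sz_pair]; omega
  · obtain ⟨a, b⟩ := p
    refine (tRuns_case_cons ((tRuns_swap (rep a) (rep b)).seq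
      ((tRuns_drop (rep b)).frame [rep a]))).mono ?_
    simp only [sz, rep_pair, BT.size]; omega

theorem PT.snd : PT (fun p : α × β => p.2) := by
  refine ⟨PB.sz.mono fun p => ?_, caseTree drop .skip,
    fun p => 14 * sz p + 10, ((PB.const 14).mul PB.sz).add (PB.const 10), fun p => ?_⟩
  · obtain ⟨a, b⟩ := p; simp only [sz_pair]; omega
  · obtain ⟨a, b⟩ := p
    refine (tRuns_case_cons ((tRuns_drop (rep a)).frame [rep b])).mono ?_
    simp only [sz, rep_pair, BT.size]; omega

theorem PT.fst' {f : α → β × γ} (h : PT f) : PT (fun x => (f x).1) := PT.fst.comp h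
theorem PT.snd' {f : α → β × γ} (h : PT f) : PT (fun x => (f x).2) := PT.snd.comp h

theorem PT.cond {b : α → Bool} {f g : α → β} (hb : PT b) (hf : PT f) (hg : PT g) :
    PT (fun x => bif b x then f x else g x) := by
  obtain ⟨hbs, p, t, ht, hp⟩ := hb
  obtain ⟨hfs, p', t', ht', hp'⟩ := hf
  obtain ⟨hgs, p'', t'', ht'', hp''⟩ := hg
  refine ⟨(hfs.add hgs).mono fun x => by dsimp only; cases b x <;> simp,
    .seq dup (.seq p (caseTree (.seq drop (.seq drop p')) p'')),
    fun x => (12 * sz x + 5) + (t x + (t' x + t'' x + 30)), ?_, fun x => ?_⟩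
  · exact (((PB.const 12).mul PB.sz).add (PB.const 5)).add (ht.add ((ht'.add ht'').add
      (PB.const 30)))
  · refine (tRuns_dup (rep x)).seq (((hp x).frame [rep x]).seq ?_)
    dsimp only
    cases hbx : b x with
    | false => exact (tRuns_case_nil (xs := [rep x]) (hp'' x)).mono (by omega)
    | true =>
      refine (tRuns_case_cons (((tRuns_drop .nil).frame [.nil, rep x]).seq
        (((tRuns_drop .nil).frame [rep x]).seq (hp' x)))).mono ?_
      simp only [BT.size]; omega

theorem PT.cons {f : α → β} {l : α → List β} (hf : PT f) (hl : PT l) :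
    PT (fun x => f x :: l x) := hf.pair hl

theorem PT.listCase {l : α → List γ} {f : α → β} {g : α → γ → List γ → β} (hl : PT l) (hf : PT f)
    (hg : PT (fun p : α × γ × List γ => g p.1 p.2.1 p.2.2)) :
    PT (fun x => match l x with | [] => f x | a :: t => g x a t) := by
  obtain ⟨hls, p, t, ht, hp⟩ := hl
  obtain ⟨hfs, p', t', ht', hp'⟩ := hf
  obtain ⟨⟨q, hq⟩, p'', t'', ⟨q', hq'⟩, hp''⟩ := hg
  have hB : PB (fun x => sz x + sz (l x) + 1) := (PB.sz.add hls).add (PB.const 1)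
  refine ⟨((hB.eval q).add hfs).mono fun x => ?_,
    .seq dup (.seq p (caseTree (.seq (.push .main true) (.seq swap (.seq (.push .main true) p'')))
      p')),
    fun x => (12 * sz x + 5) + (t x + (t' x + q'.eval (sz x + sz (l x) + 1) +
      7 * (sz x + sz (l x) + 1) + 20)), ?_, fun x => ?_⟩
  · dsimp only
    cases hlx : l x with
    | nil => simp
    | cons a t =>
      refine le_trans (hq (x, a, t)) ?_
      simp
  · exact (((PB.const 12).mul PB.sz).add (PB.const 5)).add (ht.add (((ht'.add (hB.eval q')).add
      ((PB.const 7).mul hB)).add (PB.const 20)))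
  · refine (tRuns_dup (rep x)).seq (((hp x).frame [rep x]).seq ?_)
    dsimp only
    cases hlx : l x with
    | nil => exact (tRuns_case_nil (hp' x)).mono (by omega)
    | cons a t =>
      have h2 := tRuns_swap (rep (a, t)) (rep x)
      refine (tRuns_case_cons (((tRuns_cons (rep a) (rep t)).frame [rep x]).seq (h2.seq
        ((tRuns_cons (rep x) (rep (a, t))).seq (hp'' (x, a, t)))))).mono ?_
      have h3 := hq' (x, a, t)
      have h4 : (rep (a, t)).size = sz (a :: t) := rfl
      have h5 : (rep x).size = sz x := rfl
      have h6 : sz (x, a, t) = sz x + sz (a :: t) + 1 := rfl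
      rw [h6] at h3
      rw [h4, h5]
      omega

/-! #### Folds -/

/-- The loop invariant keeps the unread part of the list on top of the accumulator. The body is only
required to work for accumulators that occur in the fold, so that `W` may rely on size bounds valid
just for those. -/
theorem tRuns_while_foldl {p : Prog} {f : σ → γ → σ} {W : ℕ} (l : List γ) (s : σ)
    (h : ∀ l₁ a l₂, l = l₁ ++ a :: l₂ → TRuns p [rep a, rep l₂, rep (l₁.foldl f s)]
      [rep l₂, rep (f (l₁.foldl f s) a)] W) :
    TRuns (whileCons p) [rep l, rep s] [rep (l.foldl f s)] ((W + 1) * l.length + 1) := by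
  induction l generalizing s with
  | nil => exact tRuns_while_nil
  | cons a l ih =>
    refine (tRuns_while_cons (h [] a l rfl) (ih (f s a) fun l₁ b l₂ hl => ?_)).mono ?_
    · exact h (a :: l₁) b l₂ (by rw [hl]; rfl)
    · rw [List.length_cons, Nat.mul_succ]; omega

/-- Iterating a polynomial-time step can square the size of the accumulator each time. The bound
`hfb` on all partial folds excludes this, so every step costs a polynomial in the original input. -/
theorem PT.foldl_closed {l : α → List γ} {s : α → σ} {f : σ → γ → σ} {b : α → ℕ} (hl : PT l)
    (hs : PT s) (hf : PT (fun p : γ × σ => f p.2 p.1)) (hb : PB b)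
    (hfb : ∀ x, ∀ l₁, l₁ <+: l x → sz (l₁.foldl f (s x)) ≤ b x) :
    PT (fun x => (l x).foldl f (s x)) := by
  obtain ⟨_, p, t, ⟨q, hq⟩, hp⟩ := hf
  obtain ⟨hps, p', t', ht', hp'⟩ := hl.pair hs
  have hls := hl.size
  have hB : PB (fun x => sz (l x) + b x + 1) := (hls.add hb).add (PB.const 1)
  refine ⟨hb.mono fun x => hfb x _ (List.prefix_refl _),
    -- The outer case distinction splits the pair into list and accumulator. The body turns `a, l₂,
    -- u` into `a, u, l₂`, joins `a` and `u` into the argument of `p`, and brings `l₂` back to the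
    -- top for the next test.
    .seq p' (caseTree (whileCons (.seq swapUnder (.seq (.push .main true) (.seq p swap)))) .skip),
    fun x => t' x + ((20 * (sz (l x) + b x + 1) + q.eval (sz (l x) + b x + 1) + 20 + 1) *
      sz (l x) + 2), ?_, fun x => ?_⟩
  · exact ht'.add ((((((PB.const 20).mul hB).add (hB.eval q)).add (PB.const 20)).add
      (PB.const 1)).mul hls |>.add (PB.const 2))
  · refine (hp' x).seq ((tRuns_case_cons (tRuns_while_foldl
      (W := 20 * (sz (l x) + b x + 1) + q.eval (sz (l x) + b x + 1) + 20)
      (l x) (s x) fun l₁ a l₂ hlx => ?_)).mono ?_)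
    · have h1 := hfb x l₁ ⟨a :: l₂, hlx.symm⟩
      have h2 := hfb x (l₁ ++ [a]) ⟨l₂, by rw [hlx]; simp⟩
      rw [List.foldl_append, List.foldl_cons, List.foldl_nil] at h2
      set u := l₁.foldl f (s x)
      have h3 : sz a + sz l₂ ≤ sz (l x) := by
        have := sz_append l₁ (a :: l₂)
        have := sz_pos l₁
        rw [← hlx, sz_cons] at *
        omega
      have h4 : t (a, u) ≤ q.eval (sz (l x) + b x + 1) :=
        (hq (a, u)).trans (eval_mono q (by rw [sz_pair]; omega))
      refine ((tRuns_swapUnder _ _ _).seq (((tRuns_cons (rep a) (rep u)).frame [rep l₂]).seq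
        (((hp (a, u)).frame [rep l₂]).seq (tRuns_swap _ _)))).mono ?_
      change 7 * (sz a + sz l₂ + sz u) + 8 + (1 + (t (a, u) + (7 * (sz (f u a) + sz l₂) + 6))) ≤ _
      omega
    · have h1 := length_le_sz (l x)
      have := Nat.mul_le_mul_left
        (20 * (sz (l x) + b x + 1) + q.eval (sz (l x) + b x + 1) + 20 + 1)
        (show (l x).length ≤ sz (l x) by omega)
      omega

/-- The step now depends on the context `x`; this reduces to `PT.foldl_closed` by carrying `x` along
unchanged in the accumulator. -/
theorem PT.foldl {l : α → List γ} {s : α → σ} {f : α → σ → γ → σ} {b : α → ℕ} (hl : PT l)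
    (hs : PT s) (hf : PT (fun p : α × γ × σ => f p.1 p.2.2 p.2.1)) (hb : PB b)
    (hfb : ∀ x, ∀ l₁, l₁ <+: l x → sz (l₁.foldl (f x) (s x)) ≤ b x) :
    PT (fun x => (l x).foldl (f x) (s x)) := by
  have key : ∀ (x : α) (l' : List γ) (u : σ),
      l'.foldl (fun (r : α × σ) a => (r.1, f r.1 r.2 a)) (x, u) = (x, l'.foldl (f x) u) := by
    intro x l'
    induction l' with
    | nil => intro u; rfl
    | cons a l' ih => intro u; exact ih (f x u a)
  have h := PT.foldl_closed (l := l) (s := fun x => (x, s x))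
    (f := fun (r : α × σ) a => (r.1, f r.1 r.2 a)) (b := fun x => sz x + b x + 1) hl
    (PT.id.pair hs) ?_ ((PB.sz.add hb).add (PB.const 1)) ?_
  · have h2 := h.snd'
    simp only [key] at h2
    exact h2
  · have h1 : PT (fun p : γ × α × σ => p.2.1) := PT.snd.fst'
    have h2 : PT (fun p : γ × α × σ => p.2.2) := PT.snd.snd'
    exact h1.pair (PT.comp (g := fun p : α × γ × σ => f p.1 p.2.2 p.2.1) hf
      (h1.pair (PT.fst.pair h2)))
  · intro x l₁ hl₁
    rw [key, sz_pair]
    have := hfb x l₁ hl₁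
    omega

/-- Folds in which the state grows only additively. -/
theorem PT.foldl_add {l : α → List γ} {s : α → σ} {f : α → σ → γ → σ} {b : α × γ → ℕ} (hl : PT l)
    (hs : PT s) (hf : PT (fun p : α × γ × σ => f p.1 p.2.2 p.2.1)) (hb : PB b)
    (hfb : ∀ x u a, sz (f x u a) ≤ sz u + b (x, a)) :
    PT (fun x => (l x).foldl (f x) (s x)) := by
  obtain ⟨q, hq⟩ := hb
  have hls := hl.size
  refine PT.foldl (b := fun x => sz (s x) + sz (l x) * q.eval (sz x + sz (l x) + 1)) hl hs hf
    (hs.size.add (hls.mul (((PB.sz.add hls).add (PB.const 1)).eval q))) fun x l₁ hl₁ => ?_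
  have key : ∀ l₁ : List γ, (∀ a ∈ l₁, a ∈ l x) → ∀ u, sz (l₁.foldl (f x) u) ≤
      sz u + l₁.length * q.eval (sz x + sz (l x) + 1) := by
    intro l₁
    induction l₁ with
    | nil => intro _ u; simp
    | cons a l₁ ih =>
      intro h u
      have h1 := ih (fun b hb => h b (List.mem_cons_of_mem _ hb)) (f x u a)
      have h2 := hfb x u a
      have h3 : b (x, a) ≤ q.eval (sz x + sz (l x) + 1) := by
        refine (hq (x, a)).trans (eval_mono q ?_)
        have := sz_le_of_mem (h a (by simp))
        rw [sz_pair]; omega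
      rw [List.foldl_cons, List.length_cons, Nat.succ_mul]
      omega
  refine (key l₁ (fun a ha => hl₁.subset ha) (s x)).trans ?_
  have h1 := hl₁.length_le
  have h2 := length_le_sz (l x)
  gcongr
  omega

/-- Folds in which the state remains bounded in terms of the context. -/
theorem PT.foldl_bdd {l : α → List γ} {s : α → σ} {f : α → σ → γ → σ} {b : α × γ → ℕ} (hl : PT l)
    (hs : PT s) (hf : PT (fun p : α × γ × σ => f p.1 p.2.2 p.2.1)) (hb : PB b)
    (hfb : ∀ x u a, sz (f x u a) ≤ b (x, a)) :
    PT (fun x => (l x).foldl (f x) (s x)) :=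
  PT.foldl_add hl hs hf hb fun x u a => (hfb x u a).trans (Nat.le_add_left _ _)

/-! #### List operations -/

theorem PT.reverse {l : α → List γ} (hl : PT l) : PT (fun x => (l x).reverse) := by
  have h := PT.foldl_add (f := fun _ (r : List γ) a => a :: r) (b := fun p => sz p + 1)
    hl (PT.const []) ((PT.snd.fst').cons PT.snd.snd') (PB.sz.add (PB.const 1))
    (fun x u a => by simp only [sz_cons, sz_pair]; omega)
  simpa only [foldl_cons_eq, List.append_nil] using h

theorem PT.append {l l' : α → List γ} (hl : PT l) (hl' : PT l') : PT (fun x => l x ++ l' x) := by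
  have h := PT.foldl_add (f := fun _ (r : List γ) a => a :: r) (b := fun p => sz p + 1)
    hl.reverse hl' ((PT.snd.fst').cons PT.snd.snd') (PB.sz.add (PB.const 1))
    (fun x u a => by simp only [sz_cons, sz_pair]; omega)
  simpa only [foldl_cons_eq, List.reverse_reverse] using h

theorem PT.map {l : α → List γ} {g : α → γ → δ} (hl : PT l)
    (hg : PT (fun p : α × γ => g p.1 p.2)) : PT (fun x => (l x).map (g x)) := by
  have h := PT.foldl_add (f := fun x (r : List δ) a => g x a :: r)
    (b := fun p => sz (g p.1 p.2) + 1) hl (PT.const [])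
    ((PT.comp (g := fun p : α × γ => g p.1 p.2) hg (PT.fst.pair PT.snd.fst')).cons PT.snd.snd')
    (hg.size.add (PB.const 1)) (fun x u a => by simp only [sz_cons]; omega)
  simpa only [foldl_map_cons_eq, List.append_nil, List.reverse_reverse] using h.reverse

theorem PT.tail {l : α → List γ} (hl : PT l) : PT (fun x => (l x).tail) := by
  have h := PT.listCase (f := fun _ : α => ([] : List γ)) (g := fun _ _ t => t) hl (PT.const [])
    PT.snd.snd'
  refine (congrArg PT (funext fun x => ?_)).mp h
  cases l x <;> rfl

theorem PT.headD {l : α → List γ} {f : α → γ} (hl : PT l) (hf : PT f) :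
    PT (fun x => (l x).headD (f x)) := by
  have h := PT.listCase (f := f) (g := fun _ a _ => a) hl hf PT.snd.fst'
  refine (congrArg PT (funext fun x => ?_)).mp h
  cases l x <;> rfl

theorem PT.zip {l : α → List γ} {l' : α → List δ} (hl : PT l) (hl' : PT l') :
    PT (fun x => (l x).zip (l' x)) := by
  have h := PT.foldl_add (f := fun (_ : α) (r : List δ × List (γ × δ)) a => zipStep r a)
    (s := fun x => (l' x, [])) (b := fun p => sz p + 1) hl (hl'.pair (PT.const [])) ?_
    (PB.sz.add (PB.const 1)) (fun x u a => ?_)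
  · have h2 := h.snd'.reverse
    simpa only [foldl_zipStep, List.append_nil, List.reverse_reverse] using h2
  · have h2 : PT (fun p : α × γ × List δ × List (γ × δ) => p.2.2) := PT.snd.snd'
    have h3 := PT.listCase (l := fun p : α × γ × List δ × List (γ × δ) => p.2.2.1)
      (g := fun p b t => (t, (p.2.1, b) :: p.2.2.2)) h2.fst' h2
      (PT.snd.snd'.pair (((PT.fst.snd'.fst').pair PT.snd.fst').cons (PT.fst.snd'.snd'.snd')))
    exact h3
  · obtain ⟨t, r⟩ := u
    cases t with
    | nil => simp [zipStep]
    | cons b t => simp only [zipStep, sz_pair, sz_cons]; omega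

theorem PT.zipWith {β' : Type} [Rep β'] {l : α → List γ} {l' : α → List δ} {g : α → γ → δ → β'}
    (hl : PT l) (hl' : PT l') (hg : PT (fun p : α × γ × δ => g p.1 p.2.1 p.2.2)) :
    PT (fun x => List.zipWith (g x) (l x) (l' x)) := by
  have h := PT.map (g := fun x (p : γ × δ) => g x p.1 p.2) (hl.zip hl') hg
  refine (congrArg PT (funext fun x => ?_)).mp h
  simp [List.zip, List.map_zipWith]

end

end StackProg

/-! ### Arithmetic in polynomial time -/

namespace StackProg

open Turing Computability
open StackProg.Rep (rep)

/-- The number with the given binary digits, least significant first. -/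
def val : List Bool → ℕ
  | [] => 0
  | b :: l => Nat.bit b (val l)

/-- Remove leading zeros. -/
def trim (l : List Bool) : List Bool :=
  l.reverse.foldl (fun r b => bif !b && r.isEmpty then [] else b :: r) []

instance : Rep ℕ := ⟨fun n => rep n.bits⟩

theorem sz_nat (n : ℕ) : sz n = sz n.bits := rfl

/-- Numbers are represented by their canonical digits, so computing `val` amounts to removing
superfluous zeros from the representing list. -/
theorem bits_val (l : List Bool) : (val l).bits = trim l := by
  induction l with
  | nil => simp [val, trim]
  | cons b l ih =>
    have h : trim (b :: l) = bif !b && (trim l).isEmpty then [] else b :: trim l := by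
      simp only [trim, List.reverse_cons, List.foldl_append, List.foldl_cons, List.foldl_nil]
    rw [h, ← ih, val]
    cases b with
    | true => simp
    | false =>
      by_cases h0 : val l = 0
      · simp [h0]
      · rw [Nat.bits_append_bit _ _ (fun h => absurd h h0)]
        have : (val l).bits ≠ [] := by
          intro h
          have h1 := Nat.size_eq_bits_len (val l)
          rw [h] at h1
          exact h0 (Nat.size_eq_zero.1 (by simpa using h1.symm))
        rw [List.isEmpty_eq_false_iff.2 this]
        rfl

theorem val_bits (n : ℕ) : val n.bits = n := by
  induction n using Nat.binaryRec' with
  | zero => simp [val]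
  | bit b n h ih => rw [Nat.bits_append_bit _ _ h, val, ih]

theorem sz_bits_le (l : List Bool) : sz l ≤ 4 * l.length + 1 := by
  have := sz_le_of_length_le (l := l) le_rfl (fun b _ => sz_bool_le b)
  omega

theorem le_sz_bits (l : List Bool) : 2 * l.length + 1 ≤ sz l := by
  induction l with
  | nil => simp
  | cons b l ih =>
    have := sz_pos b
    simp only [List.length_cons, sz_cons]; omega

/-- The size is not monotone, since a digit `false` contributes 2 nodes and a digit `true`
contributes 4; this discrepancy is the factor 2. -/
theorem sz_le_two_mul {m n : ℕ} (h : m ≤ n) : sz m ≤ 2 * sz n := by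
  rw [sz_nat, sz_nat]
  have h1 := sz_bits_le m.bits
  have h2 := le_sz_bits n.bits
  have h3 : m.bits.length ≤ n.bits.length := by
    rw [Nat.size_eq_bits_len, Nat.size_eq_bits_len]
    exact Nat.size_le_size h
  omega

theorem sz_nat_le (n : ℕ) : sz n ≤ 4 * n + 1 := by
  have h1 := sz_bits_le n.bits
  rw [Nat.size_eq_bits_len] at h1
  have h2 : n.size ≤ n := Nat.size_le.2 n.lt_two_pow_self
  rw [sz_nat]
  omega

section
variable {α β γ δ : Type} [Rep α] [Rep β] [Rep γ] [Rep δ]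

/-- Programs see only representing trees, so passing between types with equal representations, such
as a number and its list of bits, is free. -/
theorem PT.of_rep_eq {f : α → β} {g : α → γ} (hg : PT g) (h : ∀ x, rep (f x) = rep (g x)) :
    PT f := by
  unfold PT at *
  simpa only [sz, h] using hg

theorem PT.congr {f g : α → β} (hg : PT g) (h : ∀ x, f x = g x) : PT f :=
  hg.of_rep_eq fun x => by rw [h]

theorem PT.bits {f : α → ℕ} (hf : PT f) : PT (fun x => (f x).bits) := hf.of_rep_eq fun _ => rfl

theorem PT.bool₁ (f : Bool → β) {a : α → Bool} (ha : PT a) : PT (fun x => f (a x)) :=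
  (ha.cond (PT.const (f true)) (PT.const (f false))).congr fun x => by cases a x <;> rfl

theorem PT.bool₂ (f : Bool → Bool → β) {a b : α → Bool} (ha : PT a) (hb : PT b) :
    PT (fun x => f (a x) (b x)) :=
  (ha.cond (hb.bool₁ (f true)) (hb.bool₁ (f false))).congr fun x => by cases a x <;> rfl

theorem PT.bool₃ (f : Bool → Bool → Bool → β) {a b c : α → Bool} (ha : PT a) (hb : PT b)
    (hc : PT c) : PT (fun x => f (a x) (b x) (c x)) :=
  (ha.cond (hb.bool₂ (f true) hc) (hb.bool₂ (f false) hc)).congr fun x => by cases a x <;> rfl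

theorem PT.isEmpty {l : α → List γ} (hl : PT l) : PT (fun x => (l x).isEmpty) := by
  have h := PT.listCase (f := fun _ : α => true) (g := fun _ _ _ => false) hl (PT.const _)
    (PT.const _)
  exact h.congr fun x => by cases l x <;> rfl

theorem PT.val {l : α → List Bool} (hl : PT l) : PT (fun x => val (l x)) := by
  have h := PT.foldl_add (l := fun x => (l x).reverse) (s := fun _ : α => ([] : List Bool))
    (f := fun _ r b => bif !b && r.isEmpty then [] else b :: r)
    (b := fun p => sz p) hl.reverse (PT.const []) ?_ PB.sz (fun x u a => ?_)
  · exact h.of_rep_eq fun x => congrArg rep (bits_val (l x))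
  · exact ((PT.snd.fst'.bool₂ (fun b c => !b && c) PT.snd.snd'.isEmpty)).cond (PT.const [])
      (PT.snd.fst'.cons PT.snd.snd')
  · have := sz_pos u
    cases (!a && u.isEmpty) <;> simp <;> omega

/-! ### Binary addition and comparison -/

/-- One step of binary addition. -/
def addStep (s : Bool × List Bool) (a : Bool × Bool) : Bool × List Bool :=
  ((a.1 && a.2) || (s.1 && (a.1 || a.2)), (a.1 ^^ a.2 ^^ s.1) :: s.2)

/-- Two lists of digits, padded with zeros and zipped. -/
def zipPad (l l' : List Bool) : List (Bool × Bool) :=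
  (l ++ l'.map fun _ => false).zip (l' ++ l.map fun _ => false)

theorem val_append (l l' : List Bool) : val (l ++ l') = val l + 2 ^ l.length * val l' := by
  induction l with
  | nil => simp [val]
  | cons b l ih =>
    simp only [List.cons_append, val, ih, Nat.bit_val, List.length_cons, pow_succ]
    ring

theorem val_map_false {γ : Type} (l : List γ) : val (l.map fun _ => false) = 0 := by
  induction l with
  | nil => rfl
  | cons a l ih => rw [List.map_cons, val, ih]; rfl

theorem val_zipPad_fst (l l' : List Bool) : val ((zipPad l l').map Prod.fst) = val l := by
  rw [zipPad, List.map_fst_zip (by simp [Nat.add_comm]), val_append, val_map_false]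
  simp

theorem val_zipPad_snd (l l' : List Bool) : val ((zipPad l l').map Prod.snd) = val l' := by
  rw [zipPad, List.map_snd_zip (by simp [Nat.add_comm]), val_append, val_map_false]
  simp

/-- Invariant of addition with carry: the digits in `s.2` are finished, most significant first, and
the carry has the weight `2 ^ s.2.length` of the next position. After the fold the carry becomes the
leading digit. -/
theorem val_foldl_addStep (l : List (Bool × Bool)) (s : Bool × List Bool) :
    val ((l.foldl addStep s).1 :: (l.foldl addStep s).2).reverse = val s.2.reverse +
      2 ^ s.2.length * (s.1.toNat + val (l.map Prod.fst) + val (l.map Prod.snd)) := by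
  induction l generalizing s with
  | nil => simp [val_append, val, Nat.bit_val]
  | cons a l ih =>
    obtain ⟨a, b⟩ := a
    obtain ⟨c, r⟩ := s
    rw [List.foldl_cons, ih]
    simp only [addStep, List.reverse_cons, val_append, List.length_reverse, List.length_cons,
      List.map_cons, val, Nat.bit_val, pow_succ]
    cases a <;> cases b <;> cases c <;> simp <;> ring

theorem PT.zipPad {l l' : α → List Bool} (hl : PT l) (hl' : PT l') :
    PT (fun x => zipPad (l x) (l' x)) :=
  (hl.append (hl'.map (g := fun _ _ => false) (PT.const _))).zip
    (hl'.append (hl.map (g := fun _ _ => false) (PT.const _)))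

theorem PT.add {f g : α → ℕ} (hf : PT f) (hg : PT g) : PT (fun x => f x + g x) := by
  have h := PT.foldl_add (f := fun (_ : α) s a => addStep s a) (s := fun _ => (false, []))
    (b := fun _ => 20) (hf.bits.zipPad hg.bits) (PT.const _) ?_ (PB.const _) (fun x u a => ?_)
  · refine ((h.fst'.cons h.snd').reverse.val).congr fun x => ?_
    rw [val_foldl_addStep, val_zipPad_fst, val_zipPad_snd, val_bits, val_bits]
    simp [StackProg.val]
  · have h1 : PT (fun p : α × (Bool × Bool) × Bool × List Bool => p.2.1.1) := PT.snd.fst'.fst'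
    have h2 : PT (fun p : α × (Bool × Bool) × Bool × List Bool => p.2.1.2) := PT.snd.fst'.snd'
    have h3 : PT (fun p : α × (Bool × Bool) × Bool × List Bool => p.2.2.1) := PT.snd.snd'.fst'
    have h4 : PT (fun p : α × (Bool × Bool) × Bool × List Bool => p.2.2.2) := PT.snd.snd'.snd'
    exact (PT.bool₃ (fun a b c => (a && b) || (c && (a || b))) h1 h2 h3).pair
      ((PT.bool₃ (fun a b c => (a ^^ b ^^ c)) h1 h2 h3).cons h4)
  · obtain ⟨c, r⟩ := u
    have h1 := sz_bool_le ((a.1 && a.2) || (c && (a.1 || a.2)))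
    have h2 := sz_bool_le (a.1 ^^ a.2 ^^ c)
    simp only [addStep, sz_pair, sz_cons]
    omega

/-- Digits come least significant first, so each position where they differ overrides the verdict
`c` reached so far, and equal digits keep it. -/
theorem foldl_le (l : List (Bool × Bool)) (c : Bool) :
    (l.foldl (fun c a => bif a.1 == a.2 then c else a.2) c = true) ↔
      (val (l.map Prod.fst) < val (l.map Prod.snd) ∨
        (val (l.map Prod.fst) = val (l.map Prod.snd) ∧ c = true)) := by
  induction l generalizing c with
  | nil => simp [val]
  | cons a l ih =>
    obtain ⟨a, b⟩ := a
    rw [List.foldl_cons, ih]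
    simp only [List.map_cons, val, Nat.bit_val]
    cases a <;> cases b <;> cases c <;> simp <;> omega

theorem PT.le {f g : α → ℕ} (hf : PT f) (hg : PT g) : PT (fun x => decide (f x ≤ g x)) := by
  have h := PT.foldl_bdd (f := fun (_ : α) (c : Bool) (a : Bool × Bool) =>
    bif a.1 == a.2 then c else a.2) (s := fun _ => true)
    (b := fun _ => 3) (hf.bits.zipPad hg.bits) (PT.const _) ?_ (PB.const _)
    (fun x u a => sz_bool_le _)
  · refine h.congr fun x => ?_
    rw [Bool.eq_iff_iff, foldl_le, val_zipPad_fst, val_zipPad_snd, val_bits, val_bits]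
    simp only [decide_eq_true_eq, and_true]
    omega
  · exact PT.bool₃ (fun a b c => bif a == b then c else b) PT.snd.fst'.fst' PT.snd.fst'.snd'
      PT.snd.snd'

theorem PT.beq {f g : α → ℕ} (hf : PT f) (hg : PT g) : PT (fun x => f x == g x) :=
  ((hf.le hg).bool₂ (fun a b => a && b) (hg.le hf)).congr fun x => by
    rw [Bool.eq_iff_iff]
    simp only [beq_iff_eq, Bool.and_eq_true, decide_eq_true_eq]
    omega

theorem PT.min {f g : α → ℕ} (hf : PT f) (hg : PT g) : PT (fun x => min (f x) (g x)) :=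
  ((hf.le hg).cond hf hg).congr fun x => by
    by_cases h : f x ≤ g x
    · simp [h]
    · simp [h, le_of_not_ge h]

/-! #### Further list operations -/

/-- One recursion serves two purposes: it is the length when `g` is constantly false, and the index
of the first `true` (`firstTrue`) when `g` is the identity. -/
theorem PT.foldr_count {l : α → List γ} {g : γ → Bool} (hl : PT l) (hg : PT g) :
    PT (fun x => (l x).foldr (fun a r => bif g a then 0 else r + 1) 0) := by
  have key : ∀ l₁ : List γ, l₁.foldl (fun r a => bif g a then 0 else r + 1) 0 ≤ l₁.length := by
    intro l₁
    induction l₁ using List.reverseRecOn with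
    | nil => simp
    | append_singleton l a ih =>
      rw [List.foldl_append, List.foldl_cons, List.foldl_nil, List.length_append]
      cases g a <;> simp; omega
  have h := PT.foldl (f := fun (_ : α) r a => bif g a then 0 else r + 1) (s := fun _ => 0)
    (b := fun x => 4 * sz (l x) + 1) hl.reverse (PT.const 0) ?_
    (((PB.const 4).mul hl.size).add (PB.const 1)) (fun x l₁ hl₁ => ?_)
  · simpa only [List.foldl_reverse] using h
  · exact (hg.comp PT.snd.fst').cond (PT.const 0) (PT.snd.snd'.add (PT.const 1))
  · have h1 := key l₁
    have h2 := hl₁.length_le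
    have h3 := length_le_sz (l x)
    have h4 := sz_nat_le (l₁.foldl (fun r a => bif g a then 0 else r + 1) 0)
    rw [List.length_reverse] at h2
    omega

theorem PT.length {l : α → List γ} (hl : PT l) : PT (fun x => (l x).length) := by
  refine (PT.foldr_count (g := fun _ => false) hl (PT.const false)).congr fun x => ?_
  generalize l x = l'
  induction l' with
  | nil => rfl
  | cons a l' ih => rw [List.length_cons, ih]; rfl

theorem foldl_range {γ : Type} (l : List γ) :
    l.foldl (fun (r : ℕ × List ℕ) _ => (r.1 + 1, r.1 :: r.2)) (0, []) =
      (l.length, (List.range l.length).reverse) := by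
  induction l using List.reverseRecOn with
  | nil => rfl
  | append_singleton l a ih => simp [List.foldl_append, ih, List.range_succ]

theorem PT.range {l : α → List γ} (hl : PT l) : PT (fun x => List.range (l x).length) := by
  have h := PT.foldl (f := fun (_ : α) (r : ℕ × List ℕ) (_ : γ) => (r.1 + 1, r.1 :: r.2))
    (s := fun _ => (0, [])) (b := fun x => (4 * sz (l x) + 1) + (sz (l x) * (4 * sz (l x) + 1 + 1)
      + 1) + 1) hl (PT.const _) ?_ ?_ (fun x l₁ hl₁ => ?_)
  · refine h.snd'.reverse.congr fun x => ?_
    rw [foldl_range, List.reverse_reverse]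
  · exact (PT.snd.snd'.fst'.add (PT.const 1)).pair (PT.snd.snd'.fst'.cons PT.snd.snd'.snd')
  · have h4 := ((PB.const 4).mul hl.size).add (PB.const 1)
    exact (h4.add ((hl.size.mul (h4.add (PB.const 1))).add (PB.const 1))).add (PB.const 1)
  · rw [foldl_range, sz_pair]
    have h1 := hl₁.length_le
    have h2 := length_le_sz (l x)
    have h3 := sz_nat_le l₁.length
    have h4 := sz_le_of_length_le (l := (List.range l₁.length).reverse) (n := sz (l x))
      (m := 4 * sz (l x) + 1) (by simp; omega) (fun a ha => by
        have := sz_nat_le a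
        simp at ha
        omega)
    omega

theorem PT.filter {l : α → List γ} {g : α → γ → Bool} (hl : PT l)
    (hg : PT (fun p : α × γ => g p.1 p.2)) : PT (fun x => (l x).filter (g x)) := by
  have h := PT.foldl_add (f := fun x (r : List γ) a => bif g x a then a :: r else r)
    (b := fun p => sz p) hl.reverse (PT.const []) ?_ PB.sz (fun x u a => ?_)
  · refine h.congr fun x => ?_
    rw [List.foldl_reverse]
    induction l x with
    | nil => rfl
    | cons a l ih =>
      rw [List.filter_cons, List.foldr_cons, ← ih]
      cases g x a <;> simp
  · exact (PT.comp (g := fun p : α × γ => g p.1 p.2) hg (PT.fst.pair PT.snd.fst')).cond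
      (PT.snd.fst'.cons PT.snd.snd') PT.snd.snd'
  · cases g x a <;> simp; omega

theorem PT.all {l : α → List γ} {g : α → γ → Bool} (hl : PT l)
    (hg : PT (fun p : α × γ => g p.1 p.2)) : PT (fun x => (l x).all (g x)) := by
  have h := PT.foldl_bdd (f := fun x (r : Bool) a => g x a && r) (s := fun _ => true)
    (b := fun _ => 3) hl.reverse (PT.const _) ?_ (PB.const _) (fun x u a => sz_bool_le _)
  · refine h.congr fun x => ?_
    rw [List.foldl_reverse]
    induction l x with
    | nil => rfl
    | cons a l ih => rw [List.all_cons, List.foldr_cons, ih]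
  · exact (PT.comp (g := fun p : α × γ => g p.1 p.2) hg (PT.fst.pair PT.snd.fst')).bool₂
      (fun a b => a && b) PT.snd.snd'

theorem PT.any {l : α → List γ} {g : α → γ → Bool} (hl : PT l)
    (hg : PT (fun p : α × γ => g p.1 p.2)) : PT (fun x => (l x).any (g x)) :=
  ((hl.all (g := fun x a => !g x a) (hg.bool₁ (fun b => !b))).bool₁ (fun b => !b)).congr
    fun x => by simp [List.any_eq_not_all_not]

end

end StackProg

/-! ### The algorithm -/

namespace StackProg

open Turing Computability
open StackProg.Rep (rep)

/-- The minimum of `B` and a sum. -/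
def satAdd (B a b : ℕ) : ℕ := min (a + b) B

/-- A voter, given by its index, its voting cost, its delegation cost and the index of the voter
it approves (or the number of voters if there is none). -/
abbrev Voter := ℕ × ℕ × ℕ × ℕ

/-- The contribution of a delegating or casting voter to the cost vector of its parent: the entry
at `k` is the cost of the voter's subtree when its parent is at distance `k` from a casting
voter. -/
def childVec (w : List ℕ) : List ℕ :=
  (w.tail.map fun a => min (w.headD 0) a) ++ [w.headD 0]

/-- The costs of a voter itself, at each distance from a casting voter. -/
def ownVec (B : ℕ) (tm : List ℕ) (vt : Voter) : List ℕ :=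
  min vt.2.1 B :: tm.map fun _ => min vt.2.2.1 B

/-- Add the contribution of `q` to the cost vector `a` of the voter `i`, if `q` is a child of `i`
different from `j`. -/
def pull (B j i : ℕ) (a : List ℕ) (q : Voter × List ℕ) : List ℕ :=
  bif q.1.2.2.2 == i && !(q.1.1 == j) then List.zipWith (satAdd B) a (childVec q.2) else a

/-- The cost vector of a voter, computed from those of its children. -/
def rowVec (B : ℕ) (tm : List ℕ) (vs : List Voter) (j : ℕ) (tab : List (List ℕ)) (vt : Voter) :
    List ℕ :=
  (vs.zip tab).foldl (pull B j vt.1) (ownVec B tm vt)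

/-- The table of all cost vectors after as many rounds as there are voters. -/
def table (B : ℕ) (tm : List ℕ) (vs : List Voter) (j : ℕ) : List (List ℕ) :=
  vs.foldl (fun tab _ => vs.map (rowVec B tm vs j tab)) (vs.map (ownVec B tm))

/-- The minimal cost of the voters that reach `j`, if `j` casts its vote. -/
def rootCost (B : ℕ) (tm : List ℕ) (vs : List Voter) (j : ℕ) : ℕ :=
  (vs.zip (table B tm vs j)).foldl (fun a q => bif q.1.1 == j then q.2.headD 0 else a) 0

/-- The index of the voter approved by `i`. -/
def next (vs : List Voter) (i : ℕ) : ℕ :=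
  vs.foldl (fun a q => bif q.1 == i then q.2.2.2 else a) vs.length

/-- The voters reached from `i`. -/
def orbit (vs : List Voter) (i : ℕ) : List ℕ :=
  vs.foldl (fun o _ => next vs (o.headD i) :: o) []

/-- The cost of the component of the graph whose representative is `i`, and `0` if `i` is not the
representative of a component. -/
def compCost (B : ℕ) (tm : List ℕ) (vs : List Voter) (i : ℕ) : ℕ :=
  bif next vs i == vs.length then rootCost B tm vs i
  else bif (orbit vs i).any (fun x => x == i) && (orbit vs i).all (fun x => decide (i ≤ x)) then
    (orbit vs i).foldl (fun a x => min a (rootCost B tm vs x)) (rootCost B tm vs i)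
  else 0

/-- The minimal cost of a solution. -/
def totalCost (B : ℕ) (tm : List ℕ) (vs : List Voter) : ℕ :=
  vs.foldl (fun a vt => satAdd B a (compCost B tm vs vt.1)) 0

/-- The index of the first entry `true`. -/
def firstTrue (row : List Bool) : ℕ :=
  row.foldr (fun b r => bif b then 0 else r + 1) 0

/-- The voter with index `i` described by a list of three words. -/
def mkVoter (i : ℕ) (r : List (List Bool)) : Voter :=
  (i, val (r.headD []), val (r.tail.headD []), firstTrue (r.tail.tail.headD []))

/-- The decision algorithm, on the components of the input word. -/
def decideWords (β ℓ : ℕ) (recs : List (List (List Bool))) : Bool :=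
  decide (totalCost (β + 1)
    ((List.range recs.length).filter fun i => decide (i + 1 ≤ ℓ))
    (List.zipWith mkVoter (List.range recs.length) recs) ≤ β)

/-- The state of the parser, which reads the input word from right to left: the current sequence
of bits, the numbers read in the current block, and the blocks read. -/
abbrev PState := List Bool × List (List Bool) × List (List (List Bool))

/-- One step of the parser. -/
def parseStep (s : PState) (g : Γ') : PState :=
  match g with
  | .blank => s
  | .bit b => (b :: s.1, s.2)
  | .bra => ([], [], (s.1 :: s.2.1) :: s.2.2)
  | .ket => ([], [], s.2.2)
  | .comma => ([], s.1 :: s.2.1, s.2.2)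

/-- The decision algorithm, on the reversed input word. -/
def decideRev (w : List Γ') : Bool :=
  decideWords (val (w.foldl parseStep ([], [], [])).1)
    (val ((w.foldl parseStep ([], [], [])).2.1.headD []))
    (w.foldl parseStep ([], [], [])).2.2

/-! #### The algorithm runs in polynomial time -/

/-- Three bits coding an input symbol. -/
def code : Γ' → Bool × Bool × Bool
  | .blank => (false, false, false)
  | .comma => (false, false, true)
  | .ket => (false, true, false)
  | .bra => (false, true, true)
  | .bit b => (true, b, false)

instance : Rep Γ' := ⟨fun c => rep (code c)⟩

section
variable {α : Type} [Rep α]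

theorem PT.satAdd {B a b : α → ℕ} (hB : PT B) (ha : PT a) (hb : PT b) :
    PT (fun x => satAdd (B x) (a x) (b x)) := (ha.add hb).min hB

theorem PT.childVec {w : α → List ℕ} (hw : PT w) : PT (fun x => childVec (w x)) :=
  (hw.tail.map (g := fun x a => Min.min ((w x).headD 0) a)
    (((hw.headD (PT.const 0)).comp PT.fst).min PT.snd)).append
    ((hw.headD (PT.const 0)).cons (PT.const []))

theorem PT.ownVec {B : α → ℕ} {tm : α → List ℕ} {vt : α → Voter} (hB : PT B) (ht : PT tm)
    (hv : PT vt) : PT (fun x => ownVec (B x) (tm x) (vt x)) :=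
  ((hv.snd'.fst').min hB).cons (ht.map (g := fun x _ => Min.min (vt x).2.2.1 (B x))
    (((hv.snd'.snd'.fst').min hB).comp PT.fst))

theorem PT.pull {B j i : α → ℕ} {a : α → List ℕ} {q : α → Voter × List ℕ} (hB : PT B) (hj : PT j)
    (hi : PT i) (ha : PT a) (hq : PT q) : PT (fun x => pull (B x) (j x) (i x) (a x) (q x)) :=
  ((hq.fst'.snd'.snd'.snd'.beq hi).bool₂ (fun b c => b && !c) (hq.fst'.fst'.beq hj)).cond
    (PT.zipWith (g := fun x => StackProg.satAdd (B x)) ha hq.snd'.childVec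
      ((hB.comp PT.fst).satAdd PT.snd.fst' PT.snd.snd')) ha

theorem length_childVec_le (w : List ℕ) : (childVec w).length ≤ w.length + 1 := by
  simp [childVec]

theorem satAdd_le (B a b : ℕ) : satAdd B a b ≤ B := min_le_right _ _

theorem mem_zipWith_satAdd {B c : ℕ} {a b : List ℕ}
    (h : c ∈ List.zipWith (satAdd B) a b) : c ≤ B := by
  rw [← List.map_uncurry_zip_eq_zipWith] at h
  obtain ⟨p, _, rfl⟩ := List.mem_map.1 h
  exact satAdd_le _ _ _

/-- Either `a` is unchanged, or the new vector is no longer than that of the child and has entries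
at most `B`. The increment thus does not involve `a`, as `PT.foldl_add` demands. -/
theorem sz_pull_le (B j i : ℕ) (a : List ℕ) (q : Voter × List ℕ) :
    sz (pull B j i a q) ≤ sz a + (sz q * (2 * sz B + 1) + 1) := by
  unfold pull
  cases q.1.2.2.2 == i && !(q.1.1 == j)
  · simp
  · refine le_trans (sz_le_of_length_le (n := sz q) (m := 2 * sz B) ?_ fun c hc => ?_)
      (Nat.le_add_left _ _)
    · have h1 := length_childVec_le q.2
      have h2 := length_le_sz q.2
      have h3 : sz q = sz q.1 + sz q.2 + 1 := rfl
      rw [cond_true, List.length_zipWith]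
      omega
    · exact sz_le_two_mul (mem_zipWith_satAdd hc)

theorem PT.rowVec {B j : α → ℕ} {tm : α → List ℕ} {vs : α → List Voter} {tab : α → List (List ℕ)}
    {vt : α → Voter} (hB : PT B) (ht : PT tm) (hvs : PT vs) (hj : PT j) (htab : PT tab)
    (hv : PT vt) : PT (fun x => rowVec (B x) (tm x) (vs x) (j x) (tab x) (vt x)) := by
  refine PT.foldl_add (f := fun x => StackProg.pull (B x) (j x) (vt x).1)
    (b := fun p => sz p.2 * (2 * sz (B p.1) + 1) + 1)
    (hvs.zip htab) (hB.ownVec ht hv) ?_ ?_ (fun x u a => sz_pull_le _ _ _ _ _)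
  · exact (hB.comp PT.fst).pull (hj.comp PT.fst) (hv.comp PT.fst).fst' PT.snd.snd' PT.snd.fst'
  · exact (PT.snd.size.mul (((PB.const 2).mul (hB.comp PT.fst).size).add (PB.const 1))).add
      (PB.const 1)

theorem foldl_pull_le (B j i n : ℕ) (l : List (Voter × List ℕ)) (a : List ℕ)
    (ha : a.length ≤ n ∧ ∀ c ∈ a, c ≤ B) :
    (l.foldl (pull B j i) a).length ≤ n ∧ ∀ c ∈ l.foldl (pull B j i) a, c ≤ B := by
  induction l generalizing a with
  | nil => exact ha
  | cons q l ih =>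
    refine ih _ ?_
    unfold pull
    cases q.1.2.2.2 == i && !(q.1.1 == j)
    · exact ha
    · refine ⟨?_, fun c hc => mem_zipWith_satAdd hc⟩
      rw [cond_true, List.length_zipWith]
      omega

/-- The bound does not mention `tab`: the length is limited by `tm` and the entries by `B`, so the
rounds of `table` do not compound. -/
theorem sz_rowVec_le (B : ℕ) (tm : List ℕ) (vs : List Voter) (j : ℕ) (tab : List (List ℕ))
    (vt : Voter) : sz (rowVec B tm vs j tab vt) ≤ sz tm * (2 * sz B + 1) + 1 := by
  have h := foldl_pull_le B j vt.1 (tm.length + 1) (vs.zip tab) (ownVec B tm vt)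
    ⟨by simp [ownVec], fun c hc => by
      simp only [ownVec, List.mem_cons, List.mem_map] at hc
      omega⟩
  exact sz_le_of_length_le (h.1.trans (length_le_sz tm)) fun c hc => sz_le_two_mul (h.2 c hc)

theorem PT.table {B j : α → ℕ} {tm : α → List ℕ} {vs : α → List Voter} (hB : PT B) (ht : PT tm)
    (hvs : PT vs) (hj : PT j) : PT (fun x => table (B x) (tm x) (vs x) (j x)) := by
  refine PT.foldl_bdd (f := fun x tab _ => (vs x).map (StackProg.rowVec (B x) (tm x) (vs x) (j x)
      tab)) (b := fun p => sz (vs p.1) * (sz (tm p.1) * (2 * sz (B p.1) + 1) + 1 + 1) + 1)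
    hvs (hvs.map (g := fun x => StackProg.ownVec (B x) (tm x))
      ((hB.comp PT.fst).ownVec (ht.comp PT.fst) PT.snd)) ?_ ?_ (fun x u a => ?_)
  · have h1 : PT (fun p : (α × Voter × List (List ℕ)) × Voter => p.1.1) := PT.fst.fst'
    exact (hvs.comp PT.fst).map (g := fun p : α × Voter × List (List ℕ) =>
      StackProg.rowVec (B p.1) (tm p.1) (vs p.1) (j p.1) p.2.2)
      ((hB.comp h1).rowVec (ht.comp h1) (hvs.comp h1) (hj.comp h1) PT.fst.snd'.snd' PT.snd)
  · have h1 : PT (fun p : α × Voter => p.1) := PT.fst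
    exact ((hvs.comp h1).size.mul ((((ht.comp h1).size.mul (((PB.const 2).mul
      (hB.comp h1).size).add (PB.const 1))).add (PB.const 1)).add (PB.const 1))).add (PB.const 1)
  · refine sz_le_of_length_le ?_ fun c hc => ?_
    · rw [List.length_map]
      exact (Nat.le_succ _).trans (length_le_sz (vs x))
    · obtain ⟨vt, _, rfl⟩ := List.mem_map.1 hc
      exact sz_rowVec_le _ _ _ _ _ _

theorem sz_headD_le (w : List ℕ) : sz (w.headD 0) ≤ sz w := by
  cases w with
  | nil => exact le_rfl
  | cons a w => simp only [List.headD_cons, sz_cons]; omega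

theorem PT.rootCost {B j : α → ℕ} {tm : α → List ℕ} {vs : α → List Voter} (hB : PT B) (ht : PT tm)
    (hvs : PT vs) (hj : PT j) : PT (fun x => rootCost (B x) (tm x) (vs x) (j x)) := by
  refine PT.foldl_add (f := fun x a (q : Voter × List ℕ) => bif q.1.1 == j x then q.2.headD 0
      else a) (b := fun p => sz p.2.2) (hvs.zip (hB.table ht hvs hj)) (PT.const 0) ?_
      PT.snd.snd'.size (fun x u a => ?_)
  · exact (PT.snd.fst'.fst'.fst'.beq (hj.comp PT.fst)).cond
      (PT.snd.fst'.snd'.headD (PT.const 0)) PT.snd.snd'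
  · have := sz_headD_le a.2
    cases a.1.1 == j x <;> simp only [cond_true, cond_false] <;> omega

theorem sz_next_le (vs : List Voter) (i : ℕ) : sz (next vs i) ≤ sz vs.length + sz vs := by
  have key : ∀ (l : List Voter), (∀ q ∈ l, q ∈ vs) → ∀ a, sz a ≤ sz vs.length + sz vs →
      sz (l.foldl (fun a q => bif q.1 == i then q.2.2.2 else a) a) ≤ sz vs.length + sz vs := by
    intro l
    induction l with
    | nil => exact fun _ a ha => ha
    | cons q l ih =>
      intro h a ha
      refine ih (fun b hb => h b (List.mem_cons_of_mem _ hb)) _ ?_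
      have h1 := sz_le_of_mem (h q (by simp))
      obtain ⟨q1, q2, q3, q4⟩ := q
      simp only [sz_pair] at h1
      dsimp only
      cases q1 == i
      · exact ha
      · rw [cond_true]; omega
  exact key vs (fun _ h => h) _ (Nat.le_add_right _ _)

theorem PT.next {vs : α → List Voter} {i : α → ℕ} (hvs : PT vs) (hi : PT i) :
    PT (fun x => next (vs x) (i x)) := by
  refine PT.foldl_add (f := fun x a (q : Voter) => bif q.1 == i x then q.2.2.2 else a)
      (b := fun p => sz p.2) hvs hvs.length ?_ PT.snd.size (fun x u a => ?_)
  · exact (PT.snd.fst'.fst'.beq (hi.comp PT.fst)).cond PT.snd.fst'.snd'.snd'.snd' PT.snd.snd'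
  · obtain ⟨q1, q2, q3, q4⟩ := a
    cases q1 == i x <;> simp only [cond_true, cond_false, sz_pair] <;> omega

theorem PT.orbit {vs : α → List Voter} {i : α → ℕ} (hvs : PT vs) (hi : PT i) :
    PT (fun x => orbit (vs x) (i x)) := by
  refine PT.foldl_add (f := fun x o (_ : Voter) => StackProg.next (vs x) (o.headD (i x)) :: o)
      (b := fun p => sz (vs p.1).length + sz (vs p.1) + 1) hvs (PT.const []) ?_ ?_
      (fun x u a => ?_)
  · exact ((hvs.comp PT.fst).next (PT.snd.snd'.headD (hi.comp PT.fst))).cons PT.snd.snd'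
  · exact ((hvs.comp PT.fst).length.size.add (hvs.comp PT.fst).size).add (PB.const 1)
  · have := sz_next_le (vs x) (u.headD (i x))
    simp only [sz_cons]; omega

theorem PT.compCost {B i : α → ℕ} {tm : α → List ℕ} {vs : α → List Voter} (hB : PT B) (ht : PT tm)
    (hvs : PT vs) (hi : PT i) : PT (fun x => compCost (B x) (tm x) (vs x) (i x)) := by
  have hr := hB.rootCost ht hvs hi
  have ho := hvs.orbit hi
  refine ((hvs.next hi).beq hvs.length).cond hr (((ho.any (g := fun x a => a == i x)
    (PT.snd.beq (hi.comp PT.fst))).bool₂ (fun a b => a && b)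
    (ho.all (g := fun x a => decide (i x ≤ a)) ((hi.comp PT.fst).le PT.snd))).cond ?_
    (PT.const 0))
  have h1 : PT (fun p : α × ℕ => StackProg.rootCost (B p.1) (tm p.1) (vs p.1) p.2) :=
    (hB.comp PT.fst).rootCost (ht.comp PT.fst) (hvs.comp PT.fst) PT.snd
  refine PT.foldl_bdd (f := fun x a (y : ℕ) => Min.min a (StackProg.rootCost (B x) (tm x) (vs x) y))
    (b := fun p => 2 * sz (StackProg.rootCost (B p.1) (tm p.1) (vs p.1) p.2)) ho hr ?_
    ((PB.const 2).mul h1.size) (fun x u a => sz_le_two_mul (min_le_right _ _))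
  exact PT.snd.snd'.min (PT.comp (g := fun p : α × ℕ =>
    StackProg.rootCost (B p.1) (tm p.1) (vs p.1) p.2) h1 (PT.fst.pair PT.snd.fst'))

theorem PT.totalCost {B : α → ℕ} {tm : α → List ℕ} {vs : α → List Voter} (hB : PT B) (ht : PT tm)
    (hvs : PT vs) : PT (fun x => totalCost (B x) (tm x) (vs x)) := by
  refine PT.foldl_bdd (f := fun x a (vt : Voter) => StackProg.satAdd (B x) a
      (StackProg.compCost (B x) (tm x) (vs x) vt.1)) (b := fun p => 2 * sz (B p.1)) hvs
      (PT.const 0) ?_ ((PB.const 2).mul (hB.comp PT.fst).size)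
      (fun x u a => sz_le_two_mul (satAdd_le _ _ _))
  exact (hB.comp PT.fst).satAdd PT.snd.snd' ((hB.comp PT.fst).compCost (ht.comp PT.fst)
    (hvs.comp PT.fst) PT.snd.fst'.fst')

theorem PT.mkVoter {i : α → ℕ} {r : α → List (List Bool)} (hi : PT i) (hr : PT r) :
    PT (fun x => mkVoter (i x) (r x)) :=
  hi.pair ((hr.headD (PT.const [])).val.pair ((hr.tail.headD (PT.const [])).val.pair
    (PT.foldr_count (g := fun b => b) (hr.tail.tail.headD (PT.const [])) PT.id)))

theorem PT.decideWords {β ℓ : α → ℕ} {recs : α → List (List (List Bool))} (hβ : PT β) (hℓ : PT ℓ)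
    (hr : PT recs) : PT (fun x => decideWords (β x) (ℓ x) (recs x)) :=
  ((hβ.add (PT.const 1)).totalCost
    (hr.range.filter (g := fun x i => decide (i + 1 ≤ ℓ x))
      ((PT.snd.add (PT.const 1)).le (hℓ.comp PT.fst)))
    (hr.range.zipWith (g := fun _ => StackProg.mkVoter) hr
      (PT.snd.fst'.mkVoter PT.snd.snd'))).le hβ

end

/-- Branching on an input symbol. -/
theorem PT.symbolCase {α β : Type} [Rep α] [Rep β] {g : α → Γ'} {f : α → Γ' → β} (hg : PT g)
    (hf : ∀ c, PT (fun x => f x c)) : PT (fun x => f x (g x)) := by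
  have hc : PT (fun x => code (g x)) := hg.of_rep_eq fun _ => rfl
  refine (hc.fst'.cond (hc.snd'.fst'.cond (hf (.bit true)) (hf (.bit false)))
    (hc.snd'.fst'.cond (hc.snd'.snd'.cond (hf .bra) (hf .ket))
      (hc.snd'.snd'.cond (hf .comma) (hf .blank)))).congr fun x => ?_
  rcases g x with _ | (_ | _) | _ | _ | _ <;> rfl

theorem PT.parseStep {α : Type} [Rep α] {s : α → PState} {g : α → Γ'} (hs : PT s) (hg : PT g) :
    PT (fun x => parseStep (s x) (g x)) := by
  refine PT.symbolCase (f := fun x c => StackProg.parseStep (s x) c) hg fun c => ?_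
  cases c with
  | blank => exact hs
  | bit b => exact ((PT.const b).cons hs.fst').pair hs.snd'
  | bra => exact (PT.const []).pair ((PT.const []).pair ((hs.fst'.cons hs.snd'.fst').cons
      hs.snd'.snd'))
  | ket => exact (PT.const []).pair ((PT.const []).pair hs.snd'.snd')
  | comma => exact (PT.const []).pair ((hs.fst'.cons hs.snd'.fst').pair hs.snd'.snd')

theorem sz_parseStep_le (s : PState) (g : Γ') : sz (parseStep s g) ≤ sz s + 10 := by
  obtain ⟨a, b, c⟩ := s
  have := sz_pos a
  have := sz_pos b
  cases g with
  | bit b => have := sz_bool_le b; simp only [parseStep, sz_pair, sz_cons]; omega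
  | _ => simp only [parseStep, sz_pair, sz_cons, sz_nil]; omega

theorem pt_decideRev : PT decideRev := by
  have h : PT (fun w : List Γ' => w.foldl parseStep ([], [], [])) :=
    PT.foldl_add (f := fun _ => parseStep) (b := fun _ => 10) PT.id (PT.const _)
      (PT.snd.snd'.parseStep PT.snd.fst') (PB.const 10) (fun _ u a => sz_parseStep_le u a)
  exact h.fst'.val.decideWords (h.snd'.fst'.headD (PT.const [])).val h.snd'.snd'

/-! #### Running the algorithm on words -/

/-- Read the input word, building the reversed list of its symbols on the main stack. -/
def readInput : Prog :=
  .seq (.push .main false) (.loop .inp (fun _ => true) fun (c : Γ') =>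
    .seq (pushTree (rep c)) (.push .main true))

theorem runs_push_main (i : List Γ') (m : List Bool) (b : Bool) :
    Runs (.push .main b) (st i m [] [] []) (st i (b :: m) [] [] []) 1 := by
  simpa using Runs.push .main b (st i m [] [] [])

theorem runs_pushTree (x : BT) (i : List Γ') (m : List Bool) :
    Runs (pushTree x) (st i m [] [] []) (st i (x.enc ++ m) [] [] []) x.size := by
  induction x generalizing m with
  | nil => exact runs_push_main i m false
  | cons a b iha ihb =>
    have h := (ihb m).seq ((iha (b.enc ++ m)).seq (runs_push_main i _ true))
    simp only [pushTree, BT.enc, List.cons_append, List.append_assoc]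
    exact h.mono (by simp only [BT.size]; omega)

theorem sz_symbol_le (c : Γ') : sz c ≤ 12 := by
  rcases c with _ | (_ | _) | _ | _ | _ <;> decide

theorem runs_readLoop (w : List Γ') (l : List Γ') :
    Runs (.loop .inp (fun _ => true) fun (c : Γ') => .seq (pushTree (rep c)) (.push .main true))
      (st w (rep l).enc [] [] []) (st [] (rep (w.reverse ++ l)).enc [] [] [])
      (14 * w.length + 1) := by
  induction w generalizing l with
  | nil => exact Runs.loop_nil rfl
  | cons c w ih =>
    have h := ih (c :: l)
    rw [List.reverse_cons, List.append_assoc]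
    refine Runs.mono (Runs.loop_cons (a := c) (l := w) rfl rfl (T := 13)
      (s' := st w (rep (c :: l)).enc [] [] []) ?_ h) ?_
    · have h1 := (runs_pushTree (rep c) w (rep l).enc).seq (runs_push_main w _ true)
      rw [update_inp]
      exact h1.mono (Nat.succ_le_succ (sz_symbol_le c))
    · simp only [List.length_cons]; omega

theorem runs_readInput (w : List Γ') :
    Runs readInput (st w [] [] [] []) (st [] (rep w.reverse).enc [] [] []) (14 * w.length + 2) := by
  have h := (runs_push_main w [] false).seq (runs_readLoop w [])
  rw [List.append_nil] at h
  exact h.mono (by omega)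

/-- Turn the representation of a truth value into an output symbol. -/
def writeOutput : Prog :=
  .seq (caseTree (.seq drop (.seq drop (.push .main true))) (.push .main false)) .skip

theorem runs_writeOutput (b : Bool) :
    Runs writeOutput (st [] (rep b).enc [] [] []) (st [] [b] [] [] []) 30 := by
  cases b with
  | false =>
    have h := (Runs.pop_cons (k := .main) (e := .skip)
      (c := fun (x : Bool) => cond x (.seq drop (.seq drop (.push .main true)))
        (.push .main false)) (s := st [] [false] [] [] []) (a := false) (l := []) rfl
      (by simpa using runs_push_main [] [] false)).seq (Runs.skip _)
    exact h.mono (by omega)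
  | true =>
    have h1 := tRuns_drop .nil [false]
    have h2 := tRuns_drop .nil []
    have h := (Runs.pop_cons (k := .main) (e := .skip)
      (c := fun (x : Bool) => cond x (.seq drop (.seq drop (.push .main true)))
        (.push .main false)) (s := st [] [true, false, false] [] [] []) (a := true)
        (l := [false, false]) rfl
      (by rw [update_main]; exact h1.seq (h2.seq (runs_push_main [] [] true)))).seq (Runs.skip _)
    exact h.mono (by simp [BT.size])

theorem sz_symbols_le (w : List Γ') : sz w ≤ 13 * w.length + 1 := by
  have := sz_le_of_length_le (l := w) le_rfl fun c _ => sz_symbol_le c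
  omega

/-- A problem decided by a polynomial-time function of the reversed input word is solvable in
polynomial time. -/
theorem solvableInPolyTime_of_pt {α : Type} {enc : α → List Γ'} {P : α → Prop}
    {f : List Γ' → Bool} (hf : PT f) (h : ∀ x, f (enc x).reverse = true ↔ P x) :
    SolvableInPolyTime enc P := by
  obtain ⟨_, p, t, ⟨q, hq⟩, hp⟩ := hf
  refine solvableInPolyTime_of_exec (.seq readInput (.seq p writeOutput))
    (Polynomial.C 14 * Polynomial.X + q.comp (Polynomial.C 13 * Polynomial.X + 1) +
      Polynomial.C 32) fun x => ⟨f (enc x).reverse, h x, ?_⟩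
  have h1 := hp (enc x).reverse []
  simp only [encs, List.append_nil] at h1
  refine ((runs_readInput (enc x)).seq (h1.seq (runs_writeOutput _))).mono ?_
  have h2 := (hq (enc x).reverse).trans (eval_mono q (sz_symbols_le _))
  rw [List.length_reverse] at h2
  simp only [Polynomial.eval_add, Polynomial.eval_mul, Polynomial.eval_C, Polynomial.eval_X,
    Polynomial.eval_comp, Polynomial.eval_one]
  omega

end StackProg

/-! ### Minimal costs in graphs of out-degree at most one

The voters are `0, …, n - 1`, and `f i` is the voter approved by `i`, or `n` if there is none. -/

namespace FunGraph

open Finset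

/-- `δ i` is the distance of each voter `i` from the nearest casting voter, at most `L`. -/
def Valid (n L : ℕ) (f δ : ℕ → ℕ) : Prop :=
  ∀ i < n, δ i ≤ L ∧ (δ i = 0 ∨ (f i < n ∧ δ i = δ (f i) + 1))

/-- The minimal cost of a subtree with cost function `h` of its root, if the parent of the root
has distance `k` from a casting voter. -/
def pullMin (L : ℕ) (h : ℕ → ℕ) (k : ℕ) : ℕ :=
  if k < L then min (h 0) (h (k + 1)) else h 0

/-- The children of `i` in the graph in which the edge leaving `j` is deleted. -/
def children (n : ℕ) (f : ℕ → ℕ) (j i : ℕ) : Finset ℕ :=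
  (range n).filter fun c => f c = i ∧ c ≠ j

/-- The minimal cost of the subtree of `i` of depth `t`, when `i` has distance `k` from a casting
voter and the edge leaving `j` is deleted. -/
def dp (n L : ℕ) (f : ℕ → ℕ) (own : ℕ → ℕ → ℕ) (j : ℕ) : ℕ → ℕ → ℕ → ℕ
  | 0, i, k => own i k
  | t + 1, i, k => own i k + ∑ c ∈ children n f j i, pullMin L (dp n L f own j t c) k

/-- The voters whose path reaches `j` for the first time after `s` steps. -/
def level (n : ℕ) (f : ℕ → ℕ) (j : ℕ) : ℕ → Finset ℕ
  | 0 => {j}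
  | s + 1 => (range n).filter fun c => c ≠ j ∧ f c ∈ level n f j s

open Classical in
/-- The voters whose path reaches `j`. -/
noncomputable def upstream (n : ℕ) (f : ℕ → ℕ) (j : ℕ) : Finset ℕ :=
  (range n).filter fun c => ∃ s, f^[s] c = j

/-! ### The dynamic program on the levels above a casting voter -/

section
variable {n L : ℕ} {f : ℕ → ℕ} {own : ℕ → ℕ → ℕ} {j : ℕ}

/-- Every voter of level `s + 1` is a child of exactly one voter of level `s`, namely of its image
under `f`; this is summation over the fibres of `f`. -/
theorem sum_children (F : ℕ → ℕ) (s : ℕ) :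
    ∑ i ∈ level n f j s, ∑ c ∈ children n f j i, F c = ∑ c ∈ level n f j (s + 1), F c := by
  rw [← sum_fiberwise_of_maps_to (s := level n f j (s + 1)) (t := level n f j s) (g := f)
    (fun c hc => (mem_filter.1 hc).2.2)]
  refine sum_congr rfl fun i hi => sum_congr ?_ fun _ _ => rfl
  ext c
  simp only [children, level, mem_filter, mem_range]
  constructor
  · rintro ⟨h1, rfl, h2⟩; exact ⟨⟨h1, h2, hi⟩, rfl⟩
  · rintro ⟨⟨h1, h2, h3⟩, rfl⟩; exact ⟨h1, rfl, h2⟩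

theorem sum_dp_succ (k : ℕ → ℕ) (s t : ℕ) :
    ∑ i ∈ level n f j s, dp n L f own j (t + 1) i (k i) = ∑ i ∈ level n f j s, own i (k i) +
      ∑ c ∈ level n f j (s + 1), pullMin L (dp n L f own j t c) (k (f c)) := by
  simp only [dp, sum_add_distrib]
  congr 1
  rw [← sum_children]
  refine sum_congr rfl fun i _ => sum_congr rfl fun c hc => ?_
  rw [(mem_filter.1 hc).2.1]

/-- Expand one level at a time. For a child `c`, the value at `δ c` is one of the candidates in
`pullMin`: the first if `c` casts, otherwise the second, which is admissible because `δ (f c) + 1 =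
δ c ≤ L` forces `δ (f c) < L`. -/
theorem sum_dp_le {δ : ℕ → ℕ} (hδ : Valid n L f δ) (t s : ℕ) :
    ∑ i ∈ level n f j s, dp n L f own j t i (δ i) ≤
      ∑ r ∈ range (t + 1), ∑ i ∈ level n f j (s + r), own i (δ i) := by
  induction t generalizing s with
  | zero => simp [dp]
  | succ t ih =>
    rw [sum_dp_succ, sum_range_succ', Nat.add_comm]
    refine add_le_add ?_ le_rfl
    have h := ih (s + 1)
    refine le_trans (sum_le_sum fun c hc => ?_) (h.trans (le_of_eq ?_))
    · have hc2 := mem_range.1 (mem_filter.1 hc).1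
      obtain ⟨h1, h2⟩ := hδ c hc2
      unfold pullMin
      rcases h2 with h2 | ⟨_, h2⟩
      · rw [h2]; split_ifs
        · exact min_le_left _ _
        · exact le_rfl
      · rw [if_pos (by omega), h2]; exact min_le_right _ _
    · refine sum_congr rfl fun r _ => ?_
      rw [show s + 1 + r = s + (r + 1) by omega]

/-- The optimal distance of a child whose parent has distance `k`. -/
def choice (L : ℕ) (h : ℕ → ℕ) (k : ℕ) : ℕ :=
  if k < L ∧ h (k + 1) < h 0 then k + 1 else 0

theorem apply_choice (h : ℕ → ℕ) (k : ℕ) : h (choice L h k) = pullMin L h k := by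
  unfold choice pullMin
  by_cases h1 : k < L
  · by_cases h2 : h (k + 1) < h 0
    · simp [h1, h2, h2.le]
    · simp [h1, h2, not_lt.1 h2]
  · simp [h1]

/-- Optimal distances of the voters on the levels. -/
def bestDist (n L : ℕ) (f : ℕ → ℕ) (own : ℕ → ℕ → ℕ) (j T : ℕ) : ℕ → ℕ → ℕ
  | 0, _ => 0
  | s + 1, c => choice L (dp n L f own j (T - (s + 1)) c) (bestDist n L f own j T s (f c))

/-- The same expansion as in `sum_dp_le`, with equality since `bestDist` always picks the minimizer.
The condition `s + t = T` ensures that the depth `T - (s + 1)` consulted by `bestDist` is the depth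
left in the recursion. -/
theorem sum_dp_bestDist (T t s : ℕ) (hs : s + t = T) :
    ∑ i ∈ level n f j s, dp n L f own j t i (bestDist n L f own j T s i) =
      ∑ r ∈ range (t + 1), ∑ i ∈ level n f j (s + r), own i (bestDist n L f own j T (s + r) i) := by
  induction t generalizing s with
  | zero => simp [dp]
  | succ t ih =>
    rw [sum_dp_succ, sum_range_succ', Nat.add_comm]
    congr 1
    have h := ih (s + 1) (by omega)
    rw [show T = s + 1 + t by omega] at h ⊢
    refine Eq.trans (sum_congr rfl fun c hc => ?_) (h.trans ?_)
    · rw [← apply_choice]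
      conv_rhs => rw [bestDist]
      rw [show s + 1 + t - (s + 1) = t by omega]
    · refine sum_congr rfl fun r _ => ?_
      rw [show s + 1 + r = s + (r + 1) by omega]

theorem bestDist_le (T s c : ℕ) : bestDist n L f own j T s c ≤ L := by
  cases s with
  | zero => exact Nat.zero_le _
  | succ s =>
    simp only [bestDist, choice]
    split_ifs <;> omega

theorem bestDist_succ (T s c : ℕ) : bestDist n L f own j T (s + 1) c = 0 ∨
    bestDist n L f own j T (s + 1) c = bestDist n L f own j T s (f c) + 1 := by
  simp only [bestDist, choice]
  split_ifs <;> simp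

/-! ### Levels partition the voters upstream of `j` -/

theorem level_unique {c s s' : ℕ} (h : c ∈ level n f j s) (h' : c ∈ level n f j s') : s = s' := by
  induction s generalizing c s' with
  | zero =>
    cases s' with
    | zero => rfl
    | succ s' => exact absurd (mem_singleton.1 h) (mem_filter.1 h').2.1
  | succ s ih =>
    cases s' with
    | zero => exact absurd (mem_singleton.1 h') (mem_filter.1 h).2.1
    | succ s' => rw [ih (mem_filter.1 h).2.2 (mem_filter.1 h').2.2]

theorem iterate_of_mem_level {c s : ℕ} (h : c ∈ level n f j s) : f^[s] c = j := by
  induction s generalizing c with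
  | zero => exact mem_singleton.1 h
  | succ s ih => exact ih (mem_filter.1 h).2.2

theorem lt_of_mem_level (hj : j < n) {c s : ℕ} (h : c ∈ level n f j s) : c < n := by
  cases s with
  | zero => rwa [mem_singleton.1 h]
  | succ s => exact mem_range.1 (mem_filter.1 h).1

/-- The convention `hf` makes `n` absorbing: a path that runs out of delegates never returns to a
voter. -/
theorem le_iterate (hf : ∀ x, n ≤ x → f x = n) (s : ℕ) {x : ℕ} (hx : n ≤ x) : n ≤ f^[s] x := by
  induction s generalizing x with
  | zero => exact hx
  | succ s ih => exact ih (hf x hx).ge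

theorem iterate_lt (hf : ∀ x, n ≤ x → f x = n) {s r x : ℕ} (h : f^[s] x < n) (hr : r ≤ s) :
    f^[r] x < n := by
  by_contra hx
  have := le_iterate hf (s - r) (not_lt.1 hx)
  rw [← Function.iterate_add_apply, Nat.sub_add_cancel hr] at this
  omega

theorem exists_iterate_eq {x : ℕ} (h : ∀ r ≤ n, f^[r] x < n) :
    ∃ a b, a < b ∧ b ≤ n ∧ f^[a] x = f^[b] x := by
  obtain ⟨a, ha, b, hb, hab, he⟩ := exists_ne_map_eq_of_card_lt_of_maps_to
    (s := range (n + 1)) (t := range n) (f := fun r => f^[r] x) (by simp)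
    (fun r hr => by
      have := h r (by have := mem_range.1 (mem_coe.1 hr); omega)
      simpa using this)
  simp only [mem_range] at ha hb
  rcases lt_or_gt_of_ne hab with hlt | hlt
  · exact ⟨a, b, hlt, by omega, he⟩
  · exact ⟨b, a, hlt, by omega, he.symm⟩

/-- If at least `n` steps are made, two of the voters met early on coincide by the pigeonhole
principle; cutting out the loop of length `b - a` between them shortens the path without changing
its end. -/
theorem exists_iterate_lt (hf : ∀ x, n ≤ x → f x = n) {s x : ℕ} (h : f^[s] x < n) :
    ∃ r < n, r ≤ s ∧ f^[r] x = f^[s] x := by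
  induction s using Nat.strong_induction_on with
  | _ s ih =>
    by_cases hs : s < n
    · exact ⟨s, hs, le_rfl, rfl⟩
    · obtain ⟨a, b, hab, hb, he⟩ := exists_iterate_eq (n := n) (f := f) (x := x)
        fun r hr => iterate_lt hf h (by omega)
      have h1 : f^[s - (b - a)] x = f^[s] x := by
        rw [show s - (b - a) = s - b + a by omega, Function.iterate_add_apply, he,
          ← Function.iterate_add_apply, Nat.sub_add_cancel (by omega)]
      obtain ⟨r, hr, hrs, hre⟩ := ih (s - (b - a)) (by omega) (by rw [h1]; exact h)
      exact ⟨r, hr, by omega, hre.trans h1⟩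

theorem exists_mem_level (hf : ∀ x, n ≤ x → f x = n) (hj : j < n) {c s : ℕ} (hc : c < n)
    (h : f^[s] c = j) : ∃ r ≤ s, c ∈ level n f j r := by
  induction s generalizing c with
  | zero => exact ⟨0, le_rfl, mem_singleton.2 h⟩
  | succ s ih =>
    by_cases hcj : c = j
    · exact ⟨0, Nat.zero_le _, mem_singleton.2 hcj⟩
    · have h1 : f c < n := iterate_lt hf (s := s + 1) (r := 1) (h.trans_lt hj) (by omega)
      obtain ⟨r, hr, hm⟩ := ih h1 h
      exact ⟨r + 1, by omega, mem_filter.2 ⟨mem_range.2 hc, hcj, hm⟩⟩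

theorem upstream_eq (hf : ∀ x, n ≤ x → f x = n) (hj : j < n) :
    upstream n f j = (range (n + 1)).biUnion (level n f j) := by
  ext c
  simp only [upstream, mem_filter, mem_range, mem_biUnion]
  constructor
  · rintro ⟨hc, s, hs⟩
    obtain ⟨r, hr, _, he⟩ := exists_iterate_lt hf (hs.trans_lt hj)
    obtain ⟨r', hr', hm⟩ := exists_mem_level hf hj hc (he.trans hs)
    exact ⟨r', by omega, hm⟩
  · rintro ⟨s, _, hs⟩
    exact ⟨lt_of_mem_level hj hs, s, iterate_of_mem_level hs⟩

theorem sum_upstream (hf : ∀ x, n ≤ x → f x = n) (hj : j < n) (F : ℕ → ℕ) :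
    ∑ c ∈ upstream n f j, F c = ∑ s ∈ range (n + 1), ∑ c ∈ level n f j s, F c := by
  rw [upstream_eq hf hj, sum_biUnion]
  intro s _ s' _ hss
  rw [Function.onFun, disjoint_left]
  exact fun c h h' => hss (level_unique h h')

theorem dp_le_sum (hf : ∀ x, n ≤ x → f x = n) (hj : j < n) {δ : ℕ → ℕ} (hδ : Valid n L f δ)
    (h0 : δ j = 0) : dp n L f own j n j 0 ≤ ∑ c ∈ upstream n f j, own c (δ c) := by
  have h := sum_dp_le (own := own) (j := j) hδ n 0
  simp only [level, sum_singleton, h0, Nat.zero_add] at h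
  rw [sum_upstream hf hj]
  exact h

/-- Levels are disjoint, so the level-indexed choices `bestDist` assemble to one function on the
upstream voters. The delegate is asserted to stay upstream of `j`, which is what later permits
gluing the functions of different components. -/
theorem exists_sum_eq_dp (hf : ∀ x, n ≤ x → f x = n) (hj : j < n) :
    ∃ δ : ℕ → ℕ, δ j = 0 ∧ (∀ c ∈ upstream n f j, δ c ≤ L ∧
      (δ c = 0 ∨ (f c ∈ upstream n f j ∧ δ c = δ (f c) + 1))) ∧
      ∑ c ∈ upstream n f j, own c (δ c) = dp n L f own j n j 0 := by
  classical
  -- The default `0` concerns only voters on no level, which do not lie upstream of `j`.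
  let lev : ℕ → ℕ := fun c => if h : ∃ s, c ∈ level n f j s then Nat.find h else 0
  have hlev : ∀ {c s}, c ∈ level n f j s → lev c = s := by
    intro c s h
    have h' : ∃ s, c ∈ level n f j s := ⟨s, h⟩
    simp only [lev, dif_pos h']
    exact level_unique (Nat.find_spec h') h
  refine ⟨fun c => bestDist n L f own j n (lev c) c, ?_, fun c hc => ⟨bestDist_le _ _ _, ?_⟩, ?_⟩
  · dsimp only
    rw [hlev (s := 0) (mem_singleton.2 rfl)]
    rfl
  · rw [upstream_eq hf hj] at hc ⊢
    obtain ⟨s, hs, hcs⟩ := mem_biUnion.1 hc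
    dsimp only
    rw [hlev hcs]
    cases s with
    | zero => exact Or.inl rfl
    | succ s =>
      have hfc := (mem_filter.1 hcs).2.2
      rw [hlev hfc]
      have hs' : s ∈ range (n + 1) := by rw [mem_range] at hs ⊢; omega
      exact (bestDist_succ n s c).imp_right fun h => ⟨mem_biUnion.2 ⟨s, hs', hfc⟩, h⟩
  · rw [sum_upstream hf hj]
    have h := sum_dp_bestDist (L := L) (f := f) (own := own) (j := j) (n := n) n n 0 (by omega)
    simp only [level, sum_singleton, Nat.zero_add] at h
    refine Eq.trans ?_ h.symm
    refine sum_congr rfl fun s _ => sum_congr rfl fun c hc => ?_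
    dsimp only
    rw [hlev hc]

/-! #### Representatives of the components -/

/-- The voters reached from `i`. -/
def orb (n : ℕ) (f : ℕ → ℕ) (i : ℕ) : Finset ℕ :=
  (range n).image fun t => f^[t + 1] i

/-- The representatives of the components: the voters without approved voter, and the least voter
of each cycle. -/
def IsRoot (n : ℕ) (f : ℕ → ℕ) (i : ℕ) : Prop :=
  i < n ∧ (f i = n ∨ (i ∈ orb n f i ∧ ∀ x ∈ orb n f i, i ≤ x))

/-- The voters that reach and are reached from a representative. -/
def core (n : ℕ) (f : ℕ → ℕ) (i : ℕ) : Finset ℕ :=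
  if f i = n then {i} else orb n f i

theorem mem_orb (hf : ∀ x, n ≤ x → f x = n) {i x t : ℕ} (hx : x < n) (h : f^[t + 1] i = x) :
    x ∈ orb n f i := by
  have h' : f^[t] (f i) = x := h
  obtain ⟨r, hr, _, he⟩ := exists_iterate_lt hf (h'.trans_lt hx)
  exact mem_image.2 ⟨r, mem_range.2 hr, he.trans h'⟩

theorem exists_iterate_return {i s : ℕ} (h : f^[s + 1] i = i) (t : ℕ) :
    ∃ u, f^[u] (f^[t] i) = i := by
  induction t with
  | zero => exact ⟨0, rfl⟩
  | succ t ih =>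
    obtain ⟨u, hu⟩ := ih
    cases u with
    | zero =>
      refine ⟨s, ?_⟩
      rw [Function.iterate_succ_apply', show f^[t] i = i from hu]
      exact h
    | succ u =>
      refine ⟨u, ?_⟩
      rw [Function.iterate_succ_apply']
      exact hu

theorem mem_upstream {c : ℕ} : c ∈ upstream n f j ↔ c < n ∧ ∃ s, f^[s] c = j := by
  simp [upstream]

/-- All voters on a cycle are reached by the same voters. Hence every candidate `x` for the casting
voter yields a tree on the same component. -/
theorem IsRoot.core (hf : ∀ x, n ≤ x → f x = n) {i x : ℕ} (hi : IsRoot n f i)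
    (hx : x ∈ core n f i) : x < n ∧ upstream n f x = upstream n f i := by
  obtain ⟨hin, hi⟩ := hi
  by_cases hfi : f i = n
  · rw [FunGraph.core, if_pos hfi, mem_singleton] at hx
    subst hx
    exact ⟨hin, rfl⟩
  · rw [FunGraph.core, if_neg hfi] at hx
    obtain ⟨s, _, hs⟩ := mem_image.1 (hi.resolve_left hfi).1
    obtain ⟨t, _, rfl⟩ := mem_image.1 hx
    obtain ⟨u, hu⟩ := exists_iterate_return hs (t + 1)
    have hlt : f^[t + 1] i < n := by
      by_contra h
      have := le_iterate hf u (not_lt.1 h)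
      rw [hu] at this
      omega
    refine ⟨hlt, ?_⟩
    ext c
    simp only [mem_upstream]
    refine and_congr_right fun _ => ⟨?_, ?_⟩
    · rintro ⟨a, ha⟩
      exact ⟨u + a, by rw [Function.iterate_add_apply, ha, hu]⟩
    · rintro ⟨a, ha⟩
      exact ⟨t + 1 + a, by rw [Function.iterate_add_apply, ha]⟩

theorem Valid.exists_zero {δ : ℕ → ℕ} (hδ : Valid n L f δ) {i : ℕ} (hi : i < n) :
    ∃ t, f^[t] i < n ∧ δ (f^[t] i) = 0 := by
  induction hk : δ i generalizing i with
  | zero => exact ⟨0, hi, hk⟩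
  | succ k ih =>
    rcases (hδ i hi).2 with h | ⟨h1, h2⟩
    · omega
    · obtain ⟨t, ht⟩ := ih h1 (by omega)
      exact ⟨t + 1, ht⟩

/-- A sink has nobody to delegate to. From a representative on a cycle, `δ` decreases along `f`
until it vanishes, and this happens without leaving the orbit. -/
theorem IsRoot.exists_zero (hf : ∀ x, n ≤ x → f x = n) {δ : ℕ → ℕ} (hδ : Valid n L f δ) {i : ℕ}
    (hi : IsRoot n f i) : ∃ x ∈ FunGraph.core n f i, δ x = 0 := by
  obtain ⟨hin, hi⟩ := hi
  by_cases hfi : f i = n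
  · refine ⟨i, by rw [FunGraph.core, if_pos hfi, mem_singleton], ?_⟩
    rcases (hδ i hin).2 with h | ⟨h, _⟩
    · exact h
    · omega
  · rw [FunGraph.core, if_neg hfi]
    obtain ⟨t, ht1, ht2⟩ := hδ.exists_zero hin
    cases t with
    | zero => exact ⟨i, (hi.resolve_left hfi).1, ht2⟩
    | succ t => exact ⟨_, mem_orb hf ht1 rfl, ht2⟩

/-- Follow the path from `c`. If it runs out of delegates, its last voter is a sink; otherwise some
voter repeats, and the least voter on the resulting cycle is the representative. -/
theorem exists_root (hf : ∀ x, n ≤ x → f x = n) (hle : ∀ x, f x ≤ n) {c : ℕ} (hc : c < n) :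
    ∃ i, IsRoot n f i ∧ c ∈ upstream n f i := by
  classical
  by_cases h : ∃ t, n ≤ f^[t] c
  · obtain ⟨t, ht⟩ : ∃ t, Nat.find h = t + 1 := by
      refine Nat.exists_eq_succ_of_ne_zero fun h0 => ?_
      have := Nat.find_spec h
      rw [h0] at this
      exact absurd hc (not_lt.2 this)
    have h1 : f^[t] c < n := not_le.1 (Nat.find_min h (by omega))
    have h2 : n ≤ f (f^[t] c) := by
      have := Nat.find_spec h
      rwa [ht, Function.iterate_succ_apply'] at this
    exact ⟨f^[t] c, ⟨h1, Or.inl (le_antisymm (hle _) h2)⟩, mem_upstream.2 ⟨hc, t, rfl⟩⟩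
  · push Not at h
    obtain ⟨a, b, hab, _, he⟩ := exists_iterate_eq (n := n) (f := f) (x := c) fun r _ => h r
    set z := f^[a] c with hz
    have hcyc : f^[b - a - 1 + 1] z = z := by
      rw [hz, ← Function.iterate_add_apply, show b - a - 1 + 1 + a = b by omega, ← he]
    have hP : ∃ x, ∃ t, f^[t] z = x := ⟨z, 0, rfl⟩
    obtain ⟨t, ht⟩ := Nat.find_spec hP
    set i := Nat.find hP with hi
    have hmin : ∀ t', i ≤ f^[t'] z := fun t' => Nat.find_min' hP ⟨t', rfl⟩
    obtain ⟨u, hu⟩ := exists_iterate_return hcyc t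
    rw [ht] at hu
    have hci : f^[t + a] c = i := by rw [Function.iterate_add_apply, ← hz, ht]
    have hin : i < n := hci ▸ h (t + a)
    -- From `i` go to `z` in `u` steps, once around the cycle in `b - a` steps, and on to `i` in `t`
    -- steps. The full turn makes the number of steps positive even if `t = u = 0`.
    refine ⟨i, ⟨hin, Or.inr ⟨mem_orb hf (t := t + (b - a - 1) + u) hin ?_, fun x hx => ?_⟩⟩,
      mem_upstream.2 ⟨hc, t + a, hci⟩⟩
    · rw [show t + (b - a - 1) + u + 1 = t + ((b - a - 1 + 1) + u) by omega,
        Function.iterate_add_apply, Function.iterate_add_apply f (b - a - 1 + 1) u, hu, hcyc, ht]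
    · obtain ⟨s, _, rfl⟩ := mem_image.1 hx
      have := hmin (s + 1 + t)
      rwa [Function.iterate_add_apply, ht] at this

/-- Unless `m = 0`, `i` has a delegate and hence lies on a cycle, which then contains `i'` as well.
Both are least on that cycle. -/
theorem root_unique_aux (hf : ∀ x, n ≤ x → f x = n) {i i' m : ℕ} (hi : IsRoot n f i)
    (hi' : IsRoot n f i') (hm : f^[m] i = i') : i = i' := by
  cases m with
  | zero => exact hm
  | succ m =>
    have hfi : f i ≠ n := fun h => by
      have h1 : f^[m] (f i) = i' := hm
      have := le_iterate hf m h.ge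
      have := hi'.1
      omega
    obtain ⟨h1, h2⟩ := hi.2.resolve_left hfi
    obtain ⟨s, _, hs⟩ := mem_image.1 h1
    obtain ⟨u, hu⟩ := exists_iterate_return hs (m + 1)
    rw [hm] at hu
    cases u with
    | zero => exact hu.symm
    | succ u =>
      have hfi' : f i' ≠ n := fun h => by
        have h1 : f^[u] (f i') = i := hu
        have := le_iterate hf u h.ge
        have := hi.1
        omega
      have h3 := (hi'.2.resolve_left hfi').2 i (mem_orb hf hi.1 hu)
      have h4 := h2 i' (mem_orb hf hi'.1 hm)
      omega

theorem root_unique (hf : ∀ x, n ≤ x → f x = n) {c i i' : ℕ} (hi : IsRoot n f i)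
    (hi' : IsRoot n f i') (hc : c ∈ upstream n f i) (hc' : c ∈ upstream n f i') : i = i' := by
  obtain ⟨_, s, hs⟩ := mem_upstream.1 hc
  obtain ⟨_, s', hs'⟩ := mem_upstream.1 hc'
  rcases le_total s s' with h | h
  · refine root_unique_aux hf hi hi' (m := s' - s) ?_
    rw [← hs, ← Function.iterate_add_apply, Nat.sub_add_cancel h, hs']
  · refine (root_unique_aux hf hi' hi (m := s - s') ?_).symm
    rw [← hs', ← Function.iterate_add_apply, Nat.sub_add_cancel h, hs]

open Classical in
theorem sum_range_eq_sum_roots (hf : ∀ x, n ≤ x → f x = n) (hle : ∀ x, f x ≤ n) (F : ℕ → ℕ) :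
    ∑ c ∈ range n, F c =
      ∑ i ∈ (range n).filter (IsRoot n f), ∑ c ∈ upstream n f i, F c := by
  rw [← sum_biUnion]
  · refine sum_congr ?_ fun _ _ => rfl
    ext c
    simp only [mem_range, mem_biUnion, mem_filter]
    constructor
    · intro hc
      obtain ⟨i, hi, hci⟩ := exists_root hf hle hc
      exact ⟨i, ⟨hi.1, hi⟩, hci⟩
    · rintro ⟨i, _, hci⟩
      exact (mem_upstream.1 hci).1
  · intro i hi i' hi' hii
    rw [Function.onFun, disjoint_left]
    exact fun c h h' => hii (root_unique hf (mem_filter.1 hi).2 (mem_filter.1 hi').2 h h')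

/-- The minimal cost is the sum over all components of the minimal cost over all choices of one
casting voter. -/
theorem exists_valid_iff (hf : ∀ x, n ≤ x → f x = n) (hle : ∀ x, f x ≤ n) {β : ℕ} {cc : ℕ → ℕ}
    (hcc : ∀ i, IsRoot n f i →
      (∀ x ∈ core n f i, cc i ≤ min (dp n L f own x n x 0) (β + 1)) ∧
      ∃ x ∈ core n f i, cc i = min (dp n L f own x n x 0) (β + 1))
    (hcc0 : ∀ i < n, ¬ IsRoot n f i → cc i = 0) :
    (∃ δ, Valid n L f δ ∧ ∑ c ∈ range n, own c (δ c) ≤ β) ↔ ∑ i ∈ range n, cc i ≤ β := by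
  classical
  have hsum : ∑ i ∈ range n, cc i = ∑ i ∈ (range n).filter (IsRoot n f), cc i := by
    rw [sum_filter]
    refine sum_congr rfl fun i hi => ?_
    split_ifs with h
    · rfl
    · exact hcc0 i (mem_range.1 hi) h
  rw [hsum]
  constructor
  · rintro ⟨δ, hδ, hβ⟩
    refine le_trans (sum_le_sum fun i hi => ?_)
      ((sum_range_eq_sum_roots hf hle fun c => own c (δ c)).symm.le.trans hβ)
    have hi := (mem_filter.1 hi).2
    obtain ⟨x, hx, hx0⟩ := hi.exists_zero hf hδ
    obtain ⟨hxn, hup⟩ := hi.core hf hx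
    rw [← hup]
    exact ((hcc i hi).1 x hx).trans ((min_le_left _ _).trans (dp_le_sum hf hxn hδ hx0))
  · intro hβ
    have hex : ∀ i, ∃ δ : ℕ → ℕ, IsRoot n f i → (∀ c ∈ upstream n f i, δ c ≤ L ∧
        (δ c = 0 ∨ (f c ∈ upstream n f i ∧ δ c = δ (f c) + 1))) ∧
        ∑ c ∈ upstream n f i, own c (δ c) = cc i := by
      intro i
      by_cases hi : IsRoot n f i
      · obtain ⟨x, hx, hcx⟩ := (hcc i hi).2
        obtain ⟨hxn, hup⟩ := hi.core hf hx
        obtain ⟨δ, _, h1, h2⟩ := exists_sum_eq_dp (L := L) (own := own) hf hxn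
        rw [hup] at h1 h2
        refine ⟨δ, fun _ => ⟨h1, ?_⟩⟩
        -- A single component costs no more than the total, so its minimum lies below the cutoff `β
        -- + 1` and is the exact value of `dp`.
        have h3 : cc i ≤ β := (single_le_sum (f := cc) (fun _ _ => Nat.zero_le _)
          (mem_filter.2 ⟨mem_range.2 hi.1, hi⟩)).trans hβ
        omega
      · exact ⟨fun _ => 0, fun h => absurd h hi⟩
    choose D hD using hex
    have hroot : ∀ c, ∃ i, c < n → IsRoot n f i ∧ c ∈ upstream n f i := by
      intro c
      by_cases hc : c < n
      · obtain ⟨i, hi⟩ := exists_root hf hle hc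
        exact ⟨i, fun _ => hi⟩
      · exact ⟨0, fun h => absurd h hc⟩
    choose ρ hρ using hroot
    have hρ_eq : ∀ {i c}, IsRoot n f i → c ∈ upstream n f i → ρ c = i := fun hi hc =>
      root_unique hf (hρ _ (mem_upstream.1 hc).1).1 hi (hρ _ (mem_upstream.1 hc).1).2 hc
    refine ⟨fun c => D (ρ c) c, fun c hc => ?_, ?_⟩
    · obtain ⟨hi, hci⟩ := hρ c hc
      obtain ⟨h1, h2⟩ := (hD _ hi).1 c hci
      refine ⟨h1, h2.imp_right fun ⟨h3, h4⟩ => ⟨(mem_upstream.1 h3).1, ?_⟩⟩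
      dsimp only
      rw [hρ_eq hi h3]
      exact h4
    · rw [sum_range_eq_sum_roots hf hle]
      refine le_trans (le_of_eq (sum_congr rfl fun i hi => ?_)) hβ
      have hi := (mem_filter.1 hi).2
      rw [← (hD i hi).2]
      exact sum_congr rfl fun c hc => by dsimp only; rw [hρ_eq hi hc]

/-- In a graph with `n` voters all distances are less than `n`. -/
theorem Valid.min (hf : ∀ x, n ≤ x → f x = n) {δ : ℕ → ℕ} (hδ : Valid n L f δ) :
    Valid n (min L n) f δ := by
  have key : ∀ s i, i < n → s ≤ δ i → f^[s] i < n ∧ δ (f^[s] i) + s = δ i := by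
    intro s
    induction s with
    | zero => exact fun i hi _ => ⟨hi, rfl⟩
    | succ s ih =>
      intro i hi hs
      rcases (hδ i hi).2 with h | ⟨h1, h2⟩
      · omega
      · obtain ⟨h3, h4⟩ := ih (f i) h1 (by omega)
        exact ⟨h3, by rw [Function.iterate_succ_apply]; omega⟩
  intro i hi
  refine ⟨le_min (hδ i hi).1 ?_, (hδ i hi).2⟩
  obtain ⟨h1, h2⟩ := key (δ i) i hi le_rfl
  -- The voter reached after `δ i` steps has distance `0` and is already reached after some `r < n`
  -- steps; since each step lowers the distance by one, `δ i = r`.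
  obtain ⟨r, hr, hrs, he⟩ := exists_iterate_lt hf h1
  have h3 := (key r i hi hrs).2
  rw [he] at h3
  omega

end

end FunGraph

/-! ### Correctness of the algorithm -/

namespace StackProg

open Turing Computability FunGraph

section
variable {n L : ℕ} {f v d : ℕ → ℕ} {B : ℕ} {tm : List ℕ}

/-- The list of all voters. -/
def voterList (n : ℕ) (f v d : ℕ → ℕ) : List Voter :=
  (List.range n).map fun i => (i, v i, d i, f i)

/-- The cost of voter `i` at distance `k` from a casting voter. -/
def ownCost (v d : ℕ → ℕ) (i k : ℕ) : ℕ := if k = 0 then v i else d i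

/-- The truncated values of a function on `0, …, L`. -/
def vec (B L : ℕ) (h : ℕ → ℕ) : List ℕ := (List.range (L + 1)).map fun k => min (h k) B

/-! ### The computed vectors are truncated values of the dynamic program -/

theorem ownVec_eq (htm : tm.length = L) (i p : ℕ) :
    ownVec B tm (i, v i, d i, p) = vec B L (ownCost v d i) := by
  subst htm
  refine List.ext_getElem (by simp [ownVec, vec]) fun k h1 h2 => ?_
  cases k <;> simp [ownVec, vec, ownCost]

/-- Truncation at `B` commutes with minima. The appended last entry belongs to `k = L`, where the
child is no longer allowed to delegate. -/
theorem childVec_vec (h : ℕ → ℕ) : childVec (vec B L h) = vec B L (pullMin L h) := by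
  refine List.ext_getElem (by simp [childVec, vec]) fun k h1 h2 => ?_
  have hh : (vec B L h).headD 0 = min (h 0) B := by simp [vec, List.range_succ_eq_map]
  have ht : (vec B L h).tail = (List.range L).map fun k => min (h (k + 1)) B := by
    simp [vec, List.range_succ_eq_map]
  simp only [childVec, hh, ht]
  have hk : k < L + 1 := by simpa [vec] using h2
  by_cases hkL : k < L
  · rw [List.getElem_append_left (by simpa using hkL)]
    simp only [List.map_map, List.getElem_map, List.getElem_range, vec, pullMin, if_pos hkL,
      Function.comp]
    omega
  · obtain rfl : k = L := by omega
    rw [List.getElem_append_right (by simp)]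
    simp [vec, pullMin]

/-- For natural numbers, truncating the summands at `B` does not change the truncated sum. -/
theorem zipWith_satAdd_vec (h h' : ℕ → ℕ) :
    List.zipWith (satAdd B) (vec B L h) (vec B L h') = vec B L fun k => h k + h' k := by
  refine List.ext_getElem (by simp [vec]) fun k h1 h2 => ?_
  simp only [vec, List.getElem_zipWith, List.getElem_map, List.getElem_range, satAdd]
  omega

theorem foldl_pull_eq (g : ℕ → ℕ → ℕ) (j i m : ℕ) (a : ℕ → ℕ) :
    ((List.range m).map fun c => (((c, v c, d c, f c) : Voter), vec B L (g c))).foldl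
      (pull B j i) (vec B L a) =
    vec B L fun k => a k + ∑ c ∈ children m f j i, pullMin L (g c) k := by
  induction m with
  | zero => simp [children]
  | succ m ih =>
    rw [List.range_succ, List.map_append, List.foldl_append, ih]
    simp only [List.map_cons, List.map_nil, List.foldl_cons, List.foldl_nil, pull, children]
    rw [Finset.range_add_one, Finset.filter_insert]
    by_cases h : f m = i ∧ m ≠ j
    · have h1 : (f m == i && !(m == j)) = true := by simp [h.1, h.2]
      rw [h1, cond_true, if_pos h, childVec_vec, zipWith_satAdd_vec]
      congr 1
      ext k
      rw [Finset.sum_insert (by simp)]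
      omega
    · have h1 : (f m == i && !(m == j)) = false := by
        rw [Bool.eq_false_iff]
        simpa using h
      rw [h1, cond_false, if_neg h]

theorem rowVec_eq (htm : tm.length = L) (g : ℕ → ℕ → ℕ) (j i : ℕ) :
    rowVec B tm (voterList n f v d) j ((List.range n).map fun c => vec B L (g c))
      (i, v i, d i, f i) =
    vec B L fun k => ownCost v d i k + ∑ c ∈ children n f j i, pullMin L (g c) k := by
  rw [rowVec, ownVec_eq htm, ← foldl_pull_eq, voterList]
  congr 1
  rw [List.zip_map']

theorem foldl_const {α β : Type} (F : β → β) (l : List α) (b : β) :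
    l.foldl (fun u _ => F u) b = F^[l.length] b := by
  induction l generalizing b with
  | nil => rfl
  | cons a l ih => exact ih (F b)

theorem table_eq (htm : tm.length = L) (j : ℕ) :
    table B tm (voterList n f v d) j =
      (List.range n).map fun i => vec B L (dp n L f (ownCost v d) j n i) := by
  have key : ∀ t, (fun tab => (voterList n f v d).map
      (rowVec B tm (voterList n f v d) j tab))^[t] ((voterList n f v d).map (ownVec B tm)) =
      (List.range n).map fun i => vec B L (dp n L f (ownCost v d) j t i) := by
    intro t
    induction t with
    | zero =>
      simp only [Function.iterate_zero, id, voterList, List.map_map]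
      exact List.map_congr_left fun i _ => ownVec_eq htm i (f i)
    | succ t ih =>
      rw [Function.iterate_succ_apply', ih]
      conv_lhs => rw [voterList]
      rw [List.map_map]
      exact List.map_congr_left fun i _ => rowVec_eq htm _ j i
  have h := key (voterList n f v d).length
  rw [← foldl_const] at h
  rw [table, h]
  simp [voterList]

/-- The fold keeps the last match; as the keys `0, …, m - 1` are distinct, it is a lookup with
default `a`. -/
theorem foldl_select {α : Type} (g : ℕ → α) (key val : α → ℕ) (hg : ∀ c, key (g c) = c)
    (j a m : ℕ) :
    ((List.range m).map g).foldl (fun a q => bif key q == j then val q else a) a =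
      if j < m then val (g j) else a := by
  induction m with
  | zero => simp
  | succ m ih =>
    rw [List.range_succ, List.map_append, List.foldl_append, ih]
    simp only [List.map_cons, List.map_nil, List.foldl_cons, List.foldl_nil, hg]
    by_cases h : m = j
    · subst h; simp
    · have h1 : (m == j) = false := by simpa using h
      have h2 : j < m + 1 ↔ j < m := by omega
      simp only [h1, cond_false, h2]

theorem rootCost_eq (htm : tm.length = L) {j : ℕ} (hj : j < n) :
    rootCost B tm (voterList n f v d) j = min (dp n L f (ownCost v d) j n j 0) B := by
  rw [rootCost, table_eq htm, voterList, List.zip_map']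
  refine (foldl_select (fun c => (((c, v c, d c, f c) : Voter), vec B L (dp n L f (ownCost v d) j n c)))
    (fun q => q.1.1) (fun q => q.2.headD 0) (fun c => rfl) j 0 n).trans ?_
  rw [if_pos hj]
  simp [vec, List.range_succ_eq_map]

theorem next_eq (hf : ∀ x, n ≤ x → f x = n) (i : ℕ) : next (voterList n f v d) i = f i := by
  rw [next, voterList]
  refine (foldl_select (fun c => ((c, v c, d c, f c) : Voter)) (fun q => q.1) (fun q => q.2.2.2)
    (fun c => rfl) i _ n).trans ?_
  split_ifs with h
  · rfl
  · rw [hf i (by omega)]; simp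

theorem orbit_eq (hf : ∀ x, n ≤ x → f x = n) (i : ℕ) :
    orbit (voterList n f v d) i = ((List.range n).map fun t => f^[t + 1] i).reverse := by
  rw [orbit, foldl_const]
  have key : ∀ t, (fun o : List ℕ => next (voterList n f v d) (o.headD i) :: o)^[t] [] =
      ((List.range t).map fun t => f^[t + 1] i).reverse := by
    intro t
    induction t with
    | zero => rfl
    | succ t ih =>
      rw [Function.iterate_succ_apply', ih, next_eq hf, List.range_succ, List.map_append,
        List.reverse_append]
      simp only [List.map_cons, List.map_nil, List.reverse_cons, List.reverse_nil, List.nil_append,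
        List.cons_append]
      congr 1
      -- In the first round the list is empty and the default of `headD` supplies the starting voter
      -- `i`; later the head is the voter reached last.
      cases t with
      | zero => rfl
      | succ t =>
        rw [List.range_succ, List.map_append, List.reverse_append]
        simp only [List.map_cons, List.map_nil, List.reverse_cons, List.reverse_nil,
          List.nil_append, List.cons_append, List.headD_cons]
        rw [← Function.iterate_succ_apply' f]
  rw [key]
  simp [voterList]

theorem mem_orbit (hf : ∀ x, n ≤ x → f x = n) {i x : ℕ} :
    x ∈ orbit (voterList n f v d) i ↔ x ∈ orb n f i := by
  rw [orbit_eq hf, orb]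
  simp [eq_comm]

theorem foldl_min (F : ℕ → ℕ) (l : List ℕ) (a : ℕ) :
    l.foldl (fun a x => min a (F x)) a ≤ a ∧ (∀ x ∈ l, l.foldl (fun a x => min a (F x)) a ≤ F x) ∧
      (l.foldl (fun a x => min a (F x)) a = a ∨ ∃ x ∈ l, l.foldl (fun a x => min a (F x)) a = F x) := by
  induction l generalizing a with
  | nil => simp
  | cons y l ih =>
    obtain ⟨h1, h2, h3⟩ := ih (min a (F y))
    rw [List.foldl_cons]
    set u := l.foldl (fun a x => min a (F x)) (min a (F y))
    refine ⟨h1.trans (min_le_left _ _), fun x hx => ?_, ?_⟩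
    · rcases List.mem_cons.1 hx with rfl | hx
      · exact h1.trans (min_le_right _ _)
      · exact h2 x hx
    · rcases h3 with h3 | ⟨x, hx, h3⟩
      · rcases min_choice a (F y) with h4 | h4
        · exact Or.inl (h3.trans h4)
        · exact Or.inr ⟨y, by simp, h3.trans h4⟩
      · exact Or.inr ⟨x, by simp [hx], h3⟩

theorem compCost_of_isRoot (hf : ∀ x, n ≤ x → f x = n) (htm : tm.length = L) {i : ℕ}
    (hi : IsRoot n f i) :
    (∀ x ∈ core n f i, compCost B tm (voterList n f v d) i ≤
      min (dp n L f (ownCost v d) x n x 0) B) ∧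
    ∃ x ∈ core n f i, compCost B tm (voterList n f v d) i =
      min (dp n L f (ownCost v d) x n x 0) B := by
  have hF : ∀ x ∈ core n f i, rootCost B tm (voterList n f v d) x =
      min (dp n L f (ownCost v d) x n x 0) B := fun x hx => rootCost_eq htm (hi.core hf hx).1
  have hlen : (voterList n f v d).length = n := by simp [voterList]
  rw [compCost, next_eq hf, hlen]
  by_cases hfi : f i = n
  · have hc : core n f i = {i} := if_pos hfi
    rw [hc] at hF ⊢
    have h1 : (f i == n) = true := by simpa using hfi
    rw [h1, cond_true]
    refine ⟨fun x hx => ?_, i, Finset.mem_singleton_self i, hF i (Finset.mem_singleton_self i)⟩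
    rw [Finset.mem_singleton.1 hx]
    exact (hF i (Finset.mem_singleton_self i)).le
  · have hc : core n f i = orb n f i := if_neg hfi
    rw [hc] at hF ⊢
    obtain ⟨h1, h2⟩ := hi.2.resolve_left hfi
    have h3 : (f i == n) = false := by simpa using hfi
    have h4 : ((orbit (voterList n f v d) i).any (fun x => x == i) &&
        (orbit (voterList n f v d) i).all (fun x => decide (i ≤ x))) = true := by
      simp only [Bool.and_eq_true, List.any_eq_true, List.all_eq_true, beq_iff_eq,
        decide_eq_true_eq, mem_orbit hf]
      exact ⟨⟨i, h1, rfl⟩, h2⟩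
    rw [h3, h4, cond_false, cond_true]
    obtain ⟨_, h6, h7⟩ := foldl_min (rootCost B tm (voterList n f v d))
      (orbit (voterList n f v d) i) (rootCost B tm (voterList n f v d) i)
    simp only [mem_orbit hf] at h6 h7
    refine ⟨fun x hx => (h6 x hx).trans (hF x hx).le, ?_⟩
    rcases h7 with h7 | ⟨x, hx, h7⟩
    -- The starting value of the minimum is harmless, because `i` itself lies on its cycle.
    · exact ⟨i, h1, h7.trans (hF i h1)⟩
    · exact ⟨x, hx, h7.trans (hF x hx)⟩

theorem compCost_of_not_isRoot (hf : ∀ x, n ≤ x → f x = n) {i : ℕ} (hin : i < n)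
    (hi : ¬ IsRoot n f i) : compCost B tm (voterList n f v d) i = 0 := by
  have hlen : (voterList n f v d).length = n := by simp [voterList]
  have h1 : ¬ f i = n := fun h => hi ⟨hin, Or.inl h⟩
  have h2 : ¬ (i ∈ orb n f i ∧ ∀ x ∈ orb n f i, i ≤ x) := fun h => hi ⟨hin, Or.inr h⟩
  have h3 : (f i == n) = false := by simpa using h1
  have h4 : ((orbit (voterList n f v d) i).any (fun x => x == i) &&
      (orbit (voterList n f v d) i).all (fun x => decide (i ≤ x))) = false := by
    rw [Bool.eq_false_iff]
    simp only [ne_eq, Bool.and_eq_true, List.any_eq_true, List.all_eq_true, beq_iff_eq,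
      decide_eq_true_eq, mem_orbit hf]
    rintro ⟨⟨x, hx, rfl⟩, h⟩
    exact h2 ⟨hx, h⟩
  rw [compCost, next_eq hf, hlen, h3, h4]
  rfl

theorem totalCost_eq : totalCost B tm (voterList n f v d) =
    min (∑ i ∈ Finset.range n, compCost B tm (voterList n f v d) i) B := by
  have key : ∀ (F : ℕ → ℕ) m, ((List.range m).map fun i => ((i, v i, d i, f i) : Voter)).foldl
      (fun a vt => satAdd B a (F vt.1)) 0 = min (∑ i ∈ Finset.range m, F i) B := by
    intro F m
    induction m with
    | zero => simp
    | succ m ih =>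
      rw [List.range_succ, List.map_append, List.foldl_append, ih, Finset.sum_range_succ]
      simp only [List.map_cons, List.map_nil, List.foldl_cons, List.foldl_nil, satAdd]
      omega
  exact key (compCost B tm (voterList n f v d)) n

/-- Capping a number at `β + 1` does not change whether it is at most `β`, so the capped computation
decides the exact question. -/
theorem totalCost_le_iff (hf : ∀ x, n ≤ x → f x = n) (hle : ∀ x, f x ≤ n) (htm : tm.length = L)
    (β : ℕ) : totalCost (β + 1) tm (voterList n f v d) ≤ β ↔
      ∃ δ, Valid n L f δ ∧ ∑ c ∈ Finset.range n, ownCost v d c (δ c) ≤ β := by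
  rw [exists_valid_iff hf hle (fun i hi => compCost_of_isRoot hf htm hi)
    (fun i hin hi => compCost_of_not_isRoot hf hin hi), totalCost_eq]
  omega

end

/-! #### Reading the input word -/

theorem val_encodeNat (m : ℕ) : val (encodeNat m) = m := by
  have hpos : ∀ p : PosNum, val (encodePosNum p) = (p : ℕ) := by
    intro p
    induction p with
    | one => rfl
    | bit0 p ih => rw [encodePosNum, val, ih, PosNum.cast_bit0, Nat.bit_val, Bool.toNat_false]; omega
    | bit1 p ih => rw [encodePosNum, val, ih, PosNum.cast_bit1, Nat.bit_val, Bool.toNat_true]; omega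
  have hnum : ∀ k : Num, val (encodeNum k) = (k : ℕ) := by
    intro k
    cases k with
    | zero => rfl
    | pos p => exact hpos p
  rw [encodeNat, hnum, Num.to_of_nat]

/-- The effect of reading a word from right to left. -/
def parse (w : List Γ') (s : PState) : PState := w.foldr (fun g s => parseStep s g) s

theorem parse_append (w w' : List Γ') (s : PState) : parse (w ++ w') s = parse w (parse w' s) :=
  List.foldr_append

theorem parse_bits (l : List Bool) (s : PState) : parse (l.map Γ'.bit) s = (l ++ s.1, s.2) := by
  induction l with
  | nil => rfl
  | cons b l ih =>
    change parseStep (parse (l.map Γ'.bit) s) (.bit b) = _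
    rw [ih]
    rfl

theorem parse_encodeNumber (m : ℕ) (s : PState) :
    parse (BMLInput.encodeNumber m) s = (encodeNat m, s.1 :: s.2.1, s.2.2) := by
  rw [BMLInput.encodeNumber, parse_append, parse_bits]
  simp [parse, parseStep]

/-- The row of voter `i` in the adjacency matrix. -/
def adjRow (I : BMLInput) (i : Fin I.n) : List Bool :=
  (List.finRange I.n).map fun j => decide ((i, j) ∈ I.G.E)

/-- The words describing the voter `i`. -/
def record (I : BMLInput) (i : Fin I.n) : List (List Bool) :=
  [encodeNat (I.G.v i), encodeNat (I.G.d i), adjRow I i]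

theorem parse_encodeVoter (I : BMLInput) (i : Fin I.n) (s : PState) :
    parse (I.encodeVoter i) s = ([], [], record I i :: s.2.2) := by
  have h : (List.finRange I.n).map (fun j => Γ'.bit (decide ((i, j) ∈ I.G.E))) =
      (adjRow I i).map Γ'.bit := by simp [adjRow]
  rw [BMLInput.encodeVoter, h, parse_append, parse_append, parse_append, parse_append,
    parse_encodeNumber, parse_encodeNumber, parse_bits]
  simp [parse, parseStep, record]

theorem parse_voters (I : BMLInput) (l : List (Fin I.n)) :
    parse (l.flatMap I.encodeVoter) ([], [], []) = ([], [], l.map (record I)) := by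
  induction l with
  | nil => rfl
  | cons i l ih => rw [List.flatMap_cons, parse_append, ih, parse_encodeVoter, List.map_cons]

theorem decideRev_encode (I : BMLInput) : decideRev I.encode.reverse =
    decideWords I.β I.ℓ ((List.finRange I.n).map (record I)) := by
  have h : I.encode.reverse.foldl parseStep ([], [], []) =
      (encodeNat I.β, [encodeNat I.ℓ, []], (List.finRange I.n).map (record I)) := by
    rw [List.foldl_reverse]
    change parse I.encode ([], [], []) = _
    rw [BMLInput.encode, parse_append, parse_append, parse_voters, parse_encodeNumber,
      parse_encodeNumber]
  rw [decideRev, h, List.headD_cons, val_encodeNat, val_encodeNat]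

theorem firstTrue_le (l : List Bool) : firstTrue l ≤ l.length := by
  induction l with
  | nil => simp [firstTrue]
  | cons b l ih =>
    have h : firstTrue (b :: l) = bif b then 0 else firstTrue l + 1 := rfl
    rw [h]
    cases b <;> simp [ih]

theorem getElem_firstTrue (l : List Bool) (h : firstTrue l < l.length) : l[firstTrue l] = true := by
  induction l with
  | nil => simp at h
  | cons b l ih =>
    cases b with
    | true => rfl
    | false => exact ih (Nat.lt_of_succ_lt_succ h)

theorem firstTrue_lt (l : List Bool) (h : true ∈ l) : firstTrue l < l.length := by
  induction l with
  | nil => simp at h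
  | cons b l ih =>
    cases b with
    | true => exact Nat.succ_pos _
    | false => exact Nat.succ_lt_succ (ih (by simpa using h))

section
variable (I : BMLInput)

/-- The voter approved by `i`, or the number of voters if there is none. -/
def approved (i : ℕ) : ℕ := if h : i < I.n then firstTrue (adjRow I ⟨i, h⟩) else I.n

/-- The voting costs, extended by zero. -/
def votingCost (i : ℕ) : ℕ := if h : i < I.n then I.G.v ⟨i, h⟩ else 0

/-- The delegation costs, extended by zero. -/
def delegationCost (i : ℕ) : ℕ := if h : i < I.n then I.G.d ⟨i, h⟩ else 0

theorem approved_of_le {i : ℕ} (h : I.n ≤ i) : approved I i = I.n := dif_neg (by omega)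

theorem approved_le (i : ℕ) : approved I i ≤ I.n := by
  unfold approved
  split_ifs with h
  · simpa [adjRow] using firstTrue_le (adjRow I ⟨i, h⟩)
  · exact le_rfl

theorem zipWith_mkVoter :
    List.zipWith mkVoter (List.range I.n) ((List.finRange I.n).map (record I)) =
      voterList I.n (approved I) (votingCost I) (delegationCost I) := by
  refine List.ext_getElem (by simp [voterList]) fun i h1 h2 => ?_
  have hi : i < I.n := by simpa [voterList] using h2
  simp [voterList, mkVoter, record, val_encodeNat, approved, votingCost, delegationCost, hi]

/-- The list of times matters only through its length. Intersecting with `range n` keeps it short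
even when `ℓ`, given in binary, is exponentially large. -/
theorem length_filter_range (n ℓ : ℕ) :
    ((List.range n).filter fun i => decide (i + 1 ≤ ℓ)).length = min ℓ n := by
  induction n with
  | zero => simp
  | succ n ih =>
    rw [List.range_succ, List.filter_append, List.length_append, ih]
    by_cases h : n + 1 ≤ ℓ
    · rw [Nat.min_eq_right (by omega), Nat.min_eq_right h]
      simp [show n < ℓ from h]
    · rw [Nat.min_eq_left (by omega), Nat.min_eq_left (by omega)]
      simp; omega

theorem decideRev_encode_iff : decideRev I.encode.reverse = true ↔
    ∃ δ, Valid I.n I.ℓ (approved I) δ ∧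
      ∑ i ∈ Finset.range I.n, ownCost (votingCost I) (delegationCost I) i (δ i) ≤ I.β := by
  have hf : ∀ x, I.n ≤ x → approved I x = I.n := fun x => approved_of_le I
  rw [decideRev_encode, decideWords, decide_eq_true_eq, List.length_map, List.length_finRange,
    zipWith_mkVoter, totalCost_le_iff hf (approved_le I) (length_filter_range _ _)]
  constructor
  · rintro ⟨δ, h1, h2⟩
    exact ⟨δ, fun i hi => ⟨(h1 i hi).1.trans (min_le_left _ _), (h1 i hi).2⟩, h2⟩
  · rintro ⟨δ, h1, h2⟩
    exact ⟨δ, h1.min hf, h2⟩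

/-! #### Solutions and distances -/

theorem approved_mem {i : Fin I.n} (h : approved I i < I.n) : (i, ⟨approved I i, h⟩) ∈ I.G.E := by
  have h1 : approved I i = firstTrue (adjRow I i) := by simp [approved]
  have h2 := getElem_firstTrue (adjRow I i) (by
    rw [show (adjRow I i).length = I.n by simp [adjRow], ← h1]; exact h)
  simp only [adjRow, List.getElem_map, List.getElem_finRange, decide_eq_true_eq] at h2
  convert h2 using 2
  exact Fin.ext h1

variable {I}

theorem edge_unique (hΔ : I.G.maxOutDegree ≤ 1) {i j k : Fin I.n} (hj : (i, j) ∈ I.G.E)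
    (hk : (i, k) ∈ I.G.E) : j = k := by
  have h1 : I.G.outDegree i ≤ 1 := (Finset.le_sup (Finset.mem_univ i)).trans hΔ
  have h2 := Finset.card_le_one.1 h1 (i, j) (by simp [hj]) (i, k) (by simp [hk])
  exact (Prod.mk.inj h2).2

theorem approved_eq (hΔ : I.G.maxOutDegree ≤ 1) {i j : Fin I.n} (h : (i, j) ∈ I.G.E) :
    approved I i = j := by
  have h1 : approved I i < I.n := by
    have h2 : approved I i = firstTrue (adjRow I i) := by simp [approved]
    have h3 := firstTrue_lt (adjRow I i) (by
      simp only [adjRow, List.mem_map, List.mem_finRange, true_and, decide_eq_true_eq]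
      exact ⟨j, h⟩)
    rw [h2]
    simpa [adjRow] using h3
  exact congrArg Fin.val (edge_unique hΔ (approved_mem I h1) h)

theorem sum_ownCost (C : Finset (Fin I.n)) (δ : ℕ → ℕ) (h : ∀ i : Fin I.n, i ∈ C ↔ δ i = 0) :
    ∑ i ∈ Finset.range I.n, ownCost (votingCost I) (delegationCost I) i (δ i) = I.G.cost C := by
  have key : ∀ i : Fin I.n, ownCost (votingCost I) (delegationCost I) i (δ i) =
      if i ∈ C then I.G.v i else I.G.d i := by
    intro i
    simp [ownCost, votingCost, delegationCost, h]
  rw [Finset.sum_range, CLDElection.cost, Finset.sum_congr rfl fun i _ => key i,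
    Finset.sum_ite]
  congr 2
  · ext i; simp
  · ext i; simp

/-- From a solution, take for `δ` the length of a shortest path to a casting voter; its first edge
is the only edge available. Conversely, let the voters with `δ i = 0` cast and all others use their
edge: then `δ` decreases by one along it, so the path from `i` reaches a casting voter after `δ i`
steps, which gives both reachability and the length bound. -/
theorem boundedMaxLength_iff (hΔ : I.G.maxOutDegree ≤ 1) : BoundedMaxLength I ↔
    ∃ δ, Valid I.n I.ℓ (approved I) δ ∧
      ∑ i ∈ Finset.range I.n, ownCost (votingCost I) (delegationCost I) i (δ i) ≤ I.β := by
  classical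
  constructor
  · rintro ⟨C, D, ⟨hDE, _, hex⟩, hcost, _, hlen⟩
    have hP : ∀ i : Fin I.n, ∃ k, k ≤ I.ℓ ∧ ∃ c ∈ C, HasPath D k i c := by
      intro i
      by_cases hi : i ∈ C
      · exact ⟨0, Nat.zero_le _, i, hi, rfl⟩
      · obtain ⟨c, hc, k, hk, hp⟩ := hlen i hi
        exact ⟨k, hk, c, hc, hp⟩
    let δ : ℕ → ℕ := fun i => if h : i < I.n then Nat.find (hP ⟨i, h⟩) else 0
    have hδ : ∀ i : Fin I.n, δ i = Nat.find (hP i) := fun i => dif_pos i.2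
    have h0 : ∀ i : Fin I.n, i ∈ C ↔ δ i = 0 := by
      intro i
      rw [hδ, Nat.find_eq_zero]
      constructor
      · exact fun hi => ⟨Nat.zero_le _, i, hi, rfl⟩
      · rintro ⟨_, c, hc, hp⟩
        exact (show i = c from hp) ▸ hc
    refine ⟨δ, fun i hi => ?_, (sum_ownCost C δ h0).trans_le hcost⟩
    have hi' := hδ ⟨i, hi⟩
    obtain ⟨h1, c, hc, hp⟩ := Nat.find_spec (hP ⟨i, hi⟩)
    rw [← hi'] at h1 hp
    refine ⟨h1, ?_⟩
    dsimp only at h1 hp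
    rcases Nat.eq_zero_or_eq_succ_pred (δ i) with hk | hk
    · exact Or.inl hk
    · right
      rw [hk] at hp
      obtain ⟨m, hm, hp⟩ := hp
      have hfm := approved_eq hΔ (hDE hm)
      dsimp only at hfm
      rw [hfm]
      refine ⟨m.2, le_antisymm ?_ ?_⟩
      · obtain ⟨h2, c', hc', hp'⟩ := Nat.find_spec (hP m)
        by_contra hlt
        rw [← hδ] at h2 hp'
        -- Prefixing the edge to `m` to a shortest path from `m` would give a path from `i` shorter
        -- than the minimum.
        refine Nat.find_min (hP ⟨i, hi⟩) (m := δ m + 1) (by rw [← hi']; dsimp only; omega)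
          ⟨by omega, c', hc', m, hm, hp'⟩
      · have h3 : δ m ≤ (δ i).pred := by
          rw [hδ m]
          exact Nat.find_min' (hP m) ⟨by omega, c, hc, hp⟩
        omega
  · rintro ⟨δ, hδ, hcost⟩
    let C : Finset (Fin I.n) := Finset.univ.filter fun i => δ i = 0
    let D : Finset (Fin I.n × Fin I.n) := I.G.E.filter fun e => e.1 ∉ C
    have h0 : ∀ i : Fin I.n, i ∈ C ↔ δ i = 0 := fun i => by simp [C]
    have hstep : ∀ i : Fin I.n, i ∉ C → ∃ m : Fin I.n, (i, m) ∈ D ∧ δ i = δ m + 1 := by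
      intro i hi
      rcases (hδ i i.2).2 with h | ⟨h1, h2⟩
      · exact absurd ((h0 i).2 h) hi
      · exact ⟨⟨_, h1⟩, Finset.mem_filter.2 ⟨approved_mem I h1, hi⟩, h2⟩
    have hpath : ∀ k, ∀ i : Fin I.n, δ i = k → ∃ c ∈ C, HasPath D k i c := by
      intro k
      induction k with
      | zero => exact fun i hi => ⟨i, (h0 i).2 hi, rfl⟩
      | succ k ih =>
        intro i hi
        obtain ⟨m, hm, hk⟩ := hstep i (fun h => by rw [h0] at h; omega)
        obtain ⟨c, hc, hp⟩ := ih m (by omega)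
        exact ⟨c, hc, m, hm, hp⟩
    refine ⟨C, D, ⟨Finset.filter_subset _ _, fun e he => (Finset.mem_filter.1 he).2, ?_⟩, ?_, ?_, ?_⟩
    · intro i hi
      obtain ⟨m, hm, _⟩ := hstep i hi
      exact ⟨m, hm, fun k hk => edge_unique hΔ (Finset.mem_filter.1 hk).1
        (Finset.mem_filter.1 hm).1⟩
    · rw [← sum_ownCost C δ h0]; exact hcost
    · intro i _
      obtain ⟨c, hc, hp⟩ := hpath _ i rfl
      exact ⟨c, hc, _, hp⟩
    · intro i _
      obtain ⟨c, hc, hp⟩ := hpath _ i rfl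
      exact ⟨c, hc, _, (hδ i i.2).1, hp⟩

end

end StackProg

theorem mainTheorem4 :
    SolvableInPolyTime (fun I : {I : BMLInput // I.G.maxOutDegree ≤ 1} => I.1.encode)
      (fun I => BoundedMaxLength I.1) :=
  StackProg.solvableInPolyTime_of_pt StackProg.pt_decideRev fun I =>
    (StackProg.decideRev_encode_iff I.1).trans (StackProg.boundedMaxLength_iff I.2).symm
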